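/- Let $M$ be a smooth (Hausdorff) manifold of dimension $n$, write $T^*M\setminus 0$ for the set of nonzero covectors and $\dot{\mathbb R}^n=\mathbb R^n\setminus\{0\}$. Let $A:T^*M\setminus 0\to\mathbb R$ be smooth and $1$-homogeneous, i.e. $A(\lambda\alpha)=\lambda A(\alpha)$ for all $\lambda>0$ and $\alpha \in T^*M\setminus 0$. Let $\Phi_A^t$ be the flow on $T^*M\setminus 0$ of the Hamiltonian vector field of $A$ (in canonical coordinates $(x,\eta)$: $\dot x_j=\partial A/\partial\eta_j$, $\dot\eta_j=-\partial A/\partial x_j$), let $\pi_M:T^*M\to M$ be the bundle projection, and let $\mathrm{Exp}_A^{y,t}(\eta)=\pi_M(\Phi_A^t(\eta))$ for $\eta\in T_y^*M\setminus 0$ in the domain of $\Phi_A^t$. Let $o\in M$ and let $(W,x)$ be any system of local coordinates for $M$ at $o$; points of $W$ are identified with their coordinates where needed, and $\xi\cdot dx=\sum_j\xi_j\,dx_j$ for $\xi\in\mathbb R^n$. Then there exist an open neighbourhood $V\subset W$ of $o$, an $\epsilon>0$ and a smooth function $w:(-\epsilon,\epsilon)\times V\times\dot{\mathbb R}^n\to\mathbb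 R$ such that the following hold. (i) $w$ is $1$-homogeneous in $\xi$ and, for all $(t,x,\xi)\in(-\epsilon,\epsilon)\times V\times\dot{\mathbb R}^n$, $w(0,x,\xi)=x\cdot\xi$ and $\partial_xw(t,x,\xi)\neq0$. (ii) The function $\phi(t,x,y,\xi)=w(t,x,\xi)-w(0,y,\xi)$ on $(-\epsilon,\epsilon)\times V\times V\times\dot{\mathbb R}^n$ is a phase function (smooth, $1$-homogeneous in $\xi$, with $d\phi\neq0$ everywhere) and satisfies $\partial_t\phi(t,x,y,\xi)=A(\partial_x\phi(t,x,y,\xi))$ and $\phi(0,x,y,\xi)=(x-y)\cdot\xi$. Moreover, for all $t\in(-\epsilon,\epsilon)$, $(x,y,\xi)\mapsto\phi(t,x,y,\xi)$ is an operator phase function on $V\times V\times\dot{\mathbb R}^n$, i.e. a phase function such that $\partial_x\phi\neq0$ and $\partial_y\phi\neq0$ wherever $\partial_\xi\phi=0$. (iii) For all $(t,x,y,\xi)\in(-\epsilon,\epsilon)\times V\times V\times\dot{\mathbb R}^n$, the covector $\xi\cdot dx|_y$ is in the domain of $\Phi_A^{-t}$, $$\partial_\xi w(t,x,\xi)=y\iff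 \mathrm{Exp}_A^{y,-t}(\xi\cdot dx|_y)=x,$$ and in that case $\partial_tw(t,x,\xi)=A(\xi\cdot dx|_y)$. (iv) For all $(t,x,y,\xi)\in(-\epsilon,\epsilon)\times V\times V\times\dot{\mathbb R}^n$ such that $\partial_\xi w(t,x,\xi)=y$, the map $\mathrm{Exp}_A^{y,-t}$ is differentiable at $\xi\cdot dx|_y$, with differential $D\,\mathrm{Exp}_A^{y,-t}|_{\xi\cdot dx|_y}:T_y^*M\to T_xM$, and $$\operatorname{rank}\big(\partial_\xi^2w(t,x,\xi)\big)=\operatorname{rank}\big(D\,\mathrm{Exp}_A^{y,-t}|_{\xi\cdot dx|_y}\big).$$ -/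

import Mathlib

open scoped Manifold ContDiff Topology

noncomputable section

namespace Eikonal

/-! ### The cotangent bundle -/

section Cotangent

/-- The cotangent space `T*_x M` of an `n`-dimensional manifold `M`. -/
abbrev CotSpace (n : ℕ) {M : Type*} [TopologicalSpace M]
    [ChartedSpace (EuclideanSpace ℝ (Fin n)) M] (x : M) : Type :=
  TangentSpace (𝓡 n) x →L[ℝ] ℝ

/-- The cotangent bundle `T*M`, with the topology and the smooth structure that Mathlib puts on
the bundle of continuous linear maps from `TM` to the trivial line bundle. -/
abbrev CotBundle (n : ℕ) (M : Type*) [TopologicalSpace M]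
    [ChartedSpace (EuclideanSpace ℝ (Fin n)) M] : Type _ :=
  Bundle.TotalSpace (EuclideanSpace ℝ (Fin n) →L[ℝ] ℝ)
    (fun x : M => TangentSpace (𝓡 n) x →L[ℝ] ℝ)

/-- The model with corners of `T*M`. -/
abbrev cotModel (n : ℕ) :
    ModelWithCorners ℝ (EuclideanSpace ℝ (Fin n) × (EuclideanSpace ℝ (Fin n) →L[ℝ] ℝ))
      (ModelProd (EuclideanSpace ℝ (Fin n)) (EuclideanSpace ℝ (Fin n) →L[ℝ] ℝ)) :=
  (𝓡 n).prod 𝓘(ℝ, EuclideanSpace ℝ (Fin n) →L[ℝ] ℝ)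

variable {n : ℕ} {M : Type*} [TopologicalSpace M] [ChartedSpace (EuclideanSpace ℝ (Fin n)) M]

/-- The slit cotangent bundle `T*M ∖ 0`: the covectors that are not zero. -/
def slitCotBundle (n : ℕ) (M : Type*) [TopologicalSpace M]
    [ChartedSpace (EuclideanSpace ℝ (Fin n)) M] : Set (CotBundle n M) :=
  {p | p.2 ≠ 0}

/-- The differential `d_x f`, as a point of `T*M` over `x`. -/
def differential (n : ℕ) {M : Type*} [TopologicalSpace M]
    [ChartedSpace (EuclideanSpace ℝ (Fin n)) M] (f : M → ℝ) (x : M) : CotBundle n M :=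
  ⟨x, (mfderiv (𝓡 n) 𝓘(ℝ, ℝ) f x : TangentSpace (𝓡 n) x →L[ℝ] ℝ)⟩

/-- `ξ · dx|_y = ∑ j, ξ_j dx_j|_y`, for the system of local coordinates `e = (x_1, …, x_n)`. -/
def coordForm (e : OpenPartialHomeomorph M (EuclideanSpace ℝ (Fin n)))
    (ξ : EuclideanSpace ℝ (Fin n)) (y : M) : CotSpace n y :=
  ((innerSL ℝ ξ : EuclideanSpace ℝ (Fin n) →L[ℝ] ℝ)).comp (mfderiv (𝓡 n) (𝓡 n) e y)

/-- The canonical coordinates `(x, η)` on `T*M` over the domain of the chart `e`: the covector `α`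
at `y` has `x = e y` and `η = α ∘ (De|_y)⁻¹`. -/
def canonicalCoord (e : OpenPartialHomeomorph M (EuclideanSpace ℝ (Fin n))) (p : CotBundle n M) :
    EuclideanSpace ℝ (Fin n) × (EuclideanSpace ℝ (Fin n) →L[ℝ] ℝ) :=
  (e p.proj, p.2.comp (mfderiv (𝓡 n) (𝓡 n) e p.proj).inverse)

/-- The covector with canonical coordinates `z = (x, η)`, that is `∑ j, η_j dx_j` at `e.symm x`. -/
def ofCanonical (e : OpenPartialHomeomorph M (EuclideanSpace ℝ (Fin n)))
    (z : EuclideanSpace ℝ (Fin n) × (EuclideanSpace ℝ (Fin n) →L[ℝ] ℝ)) : CotBundle n M :=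
  ⟨e.symm z.1, z.2.comp (mfderiv (𝓡 n) (𝓡 n) e (e.symm z.1))⟩

end Cotangent

/-! ### Hamiltonian flow and exponential map -/

section Hamiltonian

variable {n : ℕ} {M : Type*} [TopologicalSpace M] [ChartedSpace (EuclideanSpace ℝ (Fin n)) M]

/-- The canonical symplectic form `∑ j, dx_j ∧ dη_j` in canonical coordinates. -/
def canonicalSymplectic
    (u v : EuclideanSpace ℝ (Fin n) × (EuclideanSpace ℝ (Fin n) →L[ℝ] ℝ)) : ℝ :=
  v.2 u.1 - u.2 v.1

/-- `X` is the Hamiltonian vector of `F` at `z`, in canonical coordinates: `dF|_z = ω(X, ·)`. -/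
def IsHamiltonianVector
    (F : EuclideanSpace ℝ (Fin n) × (EuclideanSpace ℝ (Fin n) →L[ℝ] ℝ) → ℝ)
    (z X : EuclideanSpace ℝ (Fin n) × (EuclideanSpace ℝ (Fin n) →L[ℝ] ℝ)) : Prop :=
  ∀ v, fderiv ℝ F z v = canonicalSymplectic X v

/-- `γ` is, on the open set of times `J`, an integral curve of the Hamiltonian vector field of
`A : D → ℝ`: it stays in `D`, and its velocity at each time is the Hamiltonian vector of `A`, in
all canonical coordinates of `T*M` around the point. -/
def IsHamiltonianCurveOn (D : Set (CotBundle n M)) (A : CotBundle n M → ℝ)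
    (γ : ℝ → CotBundle n M) (J : Set ℝ) : Prop :=
  ContinuousOn (fun s => (γ s).proj) J ∧
    ∀ s ∈ J, γ s ∈ D ∧
      ∀ e ∈ IsManifold.maximalAtlas (𝓡 n) ∞ M, (γ s).proj ∈ e.source →
        ∃ X, HasDerivAt (fun r => canonicalCoord e (γ r)) X s ∧
          IsHamiltonianVector (fun z => A (ofCanonical e z)) (canonicalCoord e (γ s)) X

/-- `(t, p)` is in the domain of the Hamiltonian flow of `A : D → ℝ` and the flow takes `p` to `q`
in time `t`. -/
def FlowsTo (D : Set (CotBundle n M)) (A : CotBundle n M → ℝ) (t : ℝ) (p q : CotBundle n M) :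
    Prop :=
  ∃ (γ : ℝ → CotBundle n M) (a b : ℝ), 0 ∈ Set.Ioo a b ∧ t ∈ Set.Ioo a b ∧
    IsHamiltonianCurveOn D A γ (Set.Ioo a b) ∧ γ 0 = p ∧ γ t = q

/-- The domain of the time-`t` map `Φ_A^t` of the Hamiltonian flow of `A : D → ℝ`. -/
def flowDomain (D : Set (CotBundle n M)) (A : CotBundle n M → ℝ) (t : ℝ) :
    Set (CotBundle n M) :=
  {p | ∃ q, FlowsTo D A t p q}

open Classical in
/-- The Hamiltonian flow `Φ_A^t(p)` of `A : D → ℝ` (with the value `p`, of no significance, where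
`p` is not in the domain of `Φ_A^t`). -/
def hamFlow (D : Set (CotBundle n M)) (A : CotBundle n M → ℝ) (t : ℝ) (p : CotBundle n M) :
    CotBundle n M :=
  if h : ∃ q, FlowsTo D A t p q then h.choose else p

/-- The Hamiltonian exponential map `Exp_A^{y,t}(η) = π_M(Φ_A^t(η))`, for `η ∈ T*_y M`. -/
def expMap (D : Set (CotBundle n M)) (A : CotBundle n M → ℝ) (y : M) (t : ℝ)
    (η : CotSpace n y) : M :=
  (hamFlow D A t ⟨y, η⟩).proj

/-- `Exp_A^{y,t}` as a map on the normed space underlying the vector space `T*_y M` (the tangent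
space `T_y M` is the model space `ℝ^n` in Mathlib, but it carries no norm there). -/
def expMapNormed (D : Set (CotBundle n M)) (A : CotBundle n M → ℝ) (y : M) (t : ℝ) :
    (EuclideanSpace ℝ (Fin n) →L[ℝ] ℝ) → M :=
  fun η => expMap D A y t η

/-- `Exp_A^{y,t} : T*_y M → M` is differentiable at `η`. -/
def ExpDifferentiableAt (D : Set (CotBundle n M)) (A : CotBundle n M → ℝ) (y : M) (t : ℝ)
    (η : CotSpace n y) : Prop :=
  MDifferentiableAt 𝓘(ℝ, EuclideanSpace ℝ (Fin n) →L[ℝ] ℝ) (𝓡 n) (expMapNormed D A y t) η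

/-- The differential `D Exp_A^{y,t}|_η : T*_y M → T_x M`, with `x = Exp_A^{y,t}(η)`. -/
def dExp (D : Set (CotBundle n M)) (A : CotBundle n M → ℝ) (y : M) (t : ℝ) (η : CotSpace n y) :
    (EuclideanSpace ℝ (Fin n) →L[ℝ] ℝ) →L[ℝ] TangentSpace (𝓡 n) (expMap D A y t η) :=
  mfderiv 𝓘(ℝ, EuclideanSpace ℝ (Fin n) →L[ℝ] ℝ) (𝓡 n) (expMapNormed D A y t) η

end Hamiltonian

/-! ### Phase functions -/

section Phase

variable {E H P : Type*} [NormedAddCommGroup E] [NormedSpace ℝ E] [TopologicalSpace H]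
  [TopologicalSpace P] [ChartedSpace H P]
  {E' H' Q : Type*} [NormedAddCommGroup E'] [NormedSpace ℝ E'] [TopologicalSpace H']
  [TopologicalSpace Q] [ChartedSpace H' Q]

/-- `φ(x, ξ)` is a phase function on `X × (ℝ^N ∖ 0)`, with `X` an open subset of a manifold: it is
smooth, `1`-homogeneous in `ξ`, and its differential in `(x, ξ)` vanishes nowhere. -/
structure IsPhaseFunctionOn (I : ModelWithCorners ℝ E H) {N : ℕ} (X : Set P)
    (φ : P → EuclideanSpace ℝ (Fin N) → ℝ) : Prop where
  smooth : ContMDiffOn (I.prod 𝓘(ℝ, EuclideanSpace ℝ (Fin N))) 𝓘(ℝ, ℝ) ∞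
    (fun q : P × EuclideanSpace ℝ (Fin N) => φ q.1 q.2) (X ×ˢ {0}ᶜ)
  homogeneous : ∀ x ∈ X, ∀ ξ : EuclideanSpace ℝ (Fin N), ξ ≠ 0 → ∀ l : ℝ, 0 < l →
    φ x (l • ξ) = l * φ x ξ
  differential_ne_zero : ∀ x ∈ X, ∀ ξ : EuclideanSpace ℝ (Fin N), ξ ≠ 0 →
    mfderiv (I.prod 𝓘(ℝ, EuclideanSpace ℝ (Fin N))) 𝓘(ℝ, ℝ)
      (fun q : P × EuclideanSpace ℝ (Fin N) => φ q.1 q.2) (x, ξ) ≠ 0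

/-- `φ((x, y), ξ)` is an operator phase function on `X × Y × (ℝ^N ∖ 0)`: it is a phase function
such that `∂_x φ ≠ 0` and `∂_y φ ≠ 0` wherever `∂_ξ φ = 0`. -/
structure IsOperatorPhaseFunctionOn (I : ModelWithCorners ℝ E H) (I' : ModelWithCorners ℝ E' H')
    {N : ℕ} (X : Set P) (Y : Set Q) (φ : P × Q → EuclideanSpace ℝ (Fin N) → ℝ) : Prop where
  isPhaseFunctionOn : IsPhaseFunctionOn (I.prod I') (X ×ˢ Y) φ
  nondegenerate : ∀ x ∈ X, ∀ y ∈ Y, ∀ ξ : EuclideanSpace ℝ (Fin N), ξ ≠ 0 →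
    gradient (φ (x, y)) ξ = 0 →
      mfderiv I 𝓘(ℝ, ℝ) (fun x' => φ (x', y) ξ) x ≠ 0 ∧
      mfderiv I' 𝓘(ℝ, ℝ) (fun y' => φ (x, y') ξ) y ≠ 0

end Phase

end Eikonal

end

/-!
The phase is built from the Hamiltonian flow itself, in the given coordinates, where `A` becomes a
function `H(x, η)` that is smooth and `1`-homogeneous on nonzero covectors. Let
`Z(t, y, ξ) = (X, Ξ)` be the position, at the time `t`, of the solution of Hamilton's equations
that starts at `(y, ξ)`. By homogeneity of `H` the flow commutes with the dilations of the fibres,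
so it is enough to consider covectors `ξ` of norm one; these form a compact set over `o`, and
therefore a single `ε` serves for all `ξ ≠ 0` and all `y` near `o`, and for `|t| < ε` the map
`y ↦ X(t, y, ξ) - y` is a contraction (`exists_isLocalFlow`). Hence `y ↦ X(-t, y, ξ)` has a smooth
inverse `x ↦ Y(t, x, ξ)` (`IsLocalFlow.exists_isBackwardInverse`), and the phase is
`w(t, x, ξ) = Y(t, x, ξ) · ξ`.

All the assertions come from one formula, the total differential of `w`
(`IsLocalFlow.fderiv_phase`): `dw = H(Y, ξ) dt + Ξ(-t, Y, ξ) · dx + Y · dξ`. It holds since the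
flow of a homogeneous Hamiltonian preserves the Liouville form `η · dx` (`IsLocalFlow.liouville`)
and since `η · ∂H/∂η = H`, by Euler. The coefficient of `dx` is a nonzero covector over `x` and,
by conservation of energy, `∂_t w = H(Y, ξ) = H(x, ∂_x w)`, the eikonal equation. The coefficient
of `dξ` says that `∂_ξ w(t, x, ξ) = y` if and only if `X(-t, y, ξ) = x`. Finally `∂_ξ² w = ∂_ξ Y`,
and differentiation of `X(-t, Y(t, x, ξ), ξ) = x` in `ξ` expresses `∂_ξ X` as the composition of
`-∂_ξ Y` with the invertible `∂_y X`, so that the two have the same rank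
(`IsLocalFlow.finrank_range_backward`).

The flow in coordinates is the flow on the manifold because a change of coordinates of the base
induces a symplectic change of canonical coordinates (`hasFDerivAt_cotangentLift`), and because a
Hamiltonian curve on `M`, which is Hausdorff, cannot leave a solution that stays over the chart
(`IsHamiltonianCurveOn.eq_ofCanonical`). Mathlib has no smooth dependence of the solutions of
ordinary differential equations on the initial values, so this is shown first, for bounded
Lipschitz vector fields: the Picard map is a smooth map on a Banach space of curves, and the fixed
point of a smooth uniform contraction depends smoothly on the parameters (`exists_flow`,
`contDiffAt_fixedPoint`).
-/

noncomputable section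

namespace Eikonal

/-! ### Smooth dependence of fixed points on parameters -/

section FixedPoint

variable {P Z : Type*} [NormedAddCommGroup P] [NormedSpace ℝ P] [CompleteSpace P]
  [NormedAddCommGroup Z] [NormedSpace ℝ Z] [CompleteSpace Z]

/-- The fixed point `g q` of a smooth family of contractions `T (q, ·)` depends smoothly on `q`: it
is the implicit function of `z - T (q, z) = 0`, since `1 - ∂T/∂z` is invertible by `‖∂T/∂z‖ ≤ 1/2`.
-/
theorem contDiffAt_fixedPoint {T : P × Z → Z} {U : Set P} {g : P → Z} {p : P} (hU : U ∈ 𝓝 p)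
    (hT : ContDiffAt ℝ ∞ T (p, g p))
    (hlip : ∀ q ∈ U, LipschitzWith 2⁻¹ fun z => T (q, z))
    (hg : ∀ q ∈ U, T (q, g q) = g q) : ContDiffAt ℝ ∞ g p := by
  set F : P × Z → Z := fun q => q.2 - T q with hF
  have hFc : ContDiffAt ℝ ∞ F (p, g p) := contDiffAt_snd.sub hT
  have hTd : HasFDerivAt T (fderiv ℝ T (p, g p)) (p, g p) :=
    (hT.differentiableAt (by simp)).hasFDerivAt
  have hFd : HasFDerivAt F (ContinuousLinearMap.snd ℝ P Z - fderiv ℝ T (p, g p)) (p, g p) :=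
    hasFDerivAt_snd.sub hTd
  set D : Z →L[ℝ] Z := fderiv ℝ T (p, g p) ∘L .inr ℝ P Z with hD
  have hDd : HasFDerivAt (fun z => T (p, z)) D (g p) :=
    HasFDerivAt.comp (g p) hTd (hasFDerivAt_prodMk_right p (g p))
  have hDn : ‖D‖ < 1 := by
    refine (hDd.le_of_lipschitz (hlip p (mem_of_mem_nhds hU))).trans_lt ?_
    norm_num
  have inv : (fderiv ℝ F (p, g p) ∘L .inr ℝ P Z).IsInvertible := by
    refine ⟨ContinuousLinearEquiv.ofUnit (Units.oneSub D hDn), ?_⟩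
    rw [hFd.fderiv]
    ext z
    simp [hD, ContinuousLinearEquiv.ofUnit]
  refine (hFc.contDiffAt_implicitFunction (by simp) inv).congr_of_eventuallyEq ?_
  filter_upwards [hU, hFc.eventually_apply_implicitFunction (by simp) inv] with q hq hq'
  have h0 : F (p, g p) = 0 := by simp [hF, hg p (mem_of_mem_nhds hU)]
  rw [h0] at hq'
  have h1 : hFc.implicitFunction (by simp) inv q = T (q, hFc.implicitFunction (by simp) inv q) :=
    sub_eq_zero.1 hq'
  have hc : ContractingWith 2⁻¹ fun z => T (q, z) :=
    ⟨by rw [← NNReal.coe_lt_coe]; norm_num, hlip q hq⟩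
  exact hc.fixedPoint_unique' (hg q hq) h1.symm

end FixedPoint

/-! ### Superposition operators -/

section Superposition

universe u

/-- Pointwise evaluation `L ↦ (v ↦ (s ↦ L s (v s)))` of a continuous family of operators. -/
def pointwiseApply (K : Type*) [TopologicalSpace K] [CompactSpace K] (E F : Type*)
    [NormedAddCommGroup E] [NormedSpace ℝ E] [NormedAddCommGroup F] [NormedSpace ℝ F] :
    C(K, E →L[ℝ] F) →L[ℝ] C(K, E) →L[ℝ] C(K, F) :=
  LinearMap.mkContinuous₂
    (LinearMap.mk₂ ℝ (fun (L : C(K, E →L[ℝ] F)) (v : C(K, E)) =>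
        (⟨fun s => L s (v s), by fun_prop⟩ : C(K, F)))
      (fun _ _ _ => by ext; simp) (fun _ _ _ => by ext; simp)
      (fun _ _ _ => by ext; simp) (fun _ _ _ => by ext; simp)) 1
    (fun L v => by
      rw [ContinuousMap.norm_le _ (by positivity)]
      intro s
      refine ((L s).le_opNorm (v s)).trans ?_
      rw [one_mul]
      gcongr
      · exact L.norm_coe_le_norm s
      · exact v.norm_coe_le_norm s)

variable {K : Type*} [TopologicalSpace K] [CompactSpace K]

@[simp]
theorem pointwiseApply_apply {E F : Type*} [NormedAddCommGroup E] [NormedSpace ℝ E]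
    [NormedAddCommGroup F] [NormedSpace ℝ F] (L : C(K, E →L[ℝ] F)) (v : C(K, E)) (s : K) :
    pointwiseApply K E F L v s = L s (v s) := rfl

/-- The operator `γ ↦ f ∘ γ` on continuous curves is differentiable where `f` has the continuous
derivative `f'`. No uniform continuity of `f'` is needed, because `γ ↦ f' ∘ γ` is continuous for
the uniform norm. -/
theorem hasFDerivAt_superposition {E F : Type*} [NormedAddCommGroup E] [NormedSpace ℝ E]
    [NormedAddCommGroup F] [NormedSpace ℝ F] (f : C(E, F)) (f' : C(E, E →L[ℝ] F))
    (hf : ∀ x, HasFDerivAt f (f' x) x) (γ : C(K, E)) :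
    HasFDerivAt (fun γ : C(K, E) => f.comp γ) (pointwiseApply K E F (f'.comp γ)) γ := by
  rw [hasFDerivAt_iff_isLittleO, Asymptotics.isLittleO_iff]
  intro c hc
  have hcont := (ContinuousMap.continuous_postcomp (X := K) f').continuousAt (x := γ)
  obtain ⟨δ, hδ, hδ'⟩ :=
    (Metric.continuousAt_iff (f := fun γ : C(K, E) => f'.comp γ) (a := γ)).1 hcont c hc
  filter_upwards [Metric.ball_mem_nhds γ hδ] with γ' hγ'
  rw [ContinuousMap.norm_le _ (by positivity)]
  intro s
  have key : ‖f (γ' s) - f (γ s) - f' (γ s) (γ' s - γ s)‖ ≤ c * ‖γ' s - γ s‖ := by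
    refine Convex.norm_image_sub_le_of_norm_hasFDerivWithin_le' (s := Metric.ball (γ s) δ)
      (fun x _ => (hf x).hasFDerivWithinAt) (fun x hx => ?_) (convex_ball _ _)
      (Metric.mem_ball_self hδ) ?_
    -- compare `γ` with its translate through `x`
    · have h1 : dist (γ + ContinuousMap.const K (x - γ s)) γ < δ := by
        rw [ContinuousMap.dist_lt_iff hδ]
        intro y
        simpa [dist_eq_norm] using hx
      have h2 := (ContinuousMap.dist_apply_le_dist s).trans (hδ' h1).le
      simpa [dist_eq_norm] using h2
    · exact (ContinuousMap.dist_apply_le_dist s).trans_lt hγ'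
  have h3 : ‖γ' s - γ s‖ ≤ ‖γ' - γ‖ := (γ' - γ).norm_coe_le_norm s
  calc _ = ‖f (γ' s) - f (γ s) - f' (γ s) (γ' s - γ s)‖ := by simp
    _ ≤ c * ‖γ' s - γ s‖ := key
    _ ≤ c * ‖γ' - γ‖ := by gcongr

/-- The operator `γ ↦ f ∘ γ` on continuous curves is smooth if `f` is; the derivative is again built
from an operator of this kind, with the values in `E →L[ℝ] F`, whence the common universe. -/
theorem contDiff_superposition {E F : Type u} [NormedAddCommGroup E] [NormedSpace ℝ E]
    [NormedAddCommGroup F] [NormedSpace ℝ F] (f : C(E, F)) (hf : ContDiff ℝ ∞ f) :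
    ContDiff ℝ ∞ (fun γ : C(K, E) => f.comp γ) := by
  rw [contDiff_infty]
  intro m
  induction m generalizing F with
  | zero => exact contDiff_zero.2 (ContinuousMap.continuous_postcomp f)
  | succ m ih =>
    have hf' : ContDiff ℝ ∞ (fderiv ℝ f) := hf.fderiv_right (by simp)
    set f' : C(E, E →L[ℝ] F) := ⟨fderiv ℝ f, hf'.continuous⟩
    push_cast
    rw [contDiff_succ_iff_hasFDerivAt]
    refine ⟨fun γ => pointwiseApply K E F (f'.comp γ), ?_, fun γ => ?_⟩
    · exact (pointwiseApply K E F).contDiff.comp (ih f' hf')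
    · exact hasFDerivAt_superposition f f'
        (fun x => (hf.differentiable (by simp) x).hasFDerivAt) γ

end Superposition

/-! ### The flow of a bounded Lipschitz vector field -/

section Flow

/-- The primitive `s ↦ ∫ r in 0..s, γ r` of a continuous curve on the unit interval. -/
def primitive (W : Type*) [NormedAddCommGroup W] [NormedSpace ℝ W] :
    C(unitInterval, W) →L[ℝ] C(unitInterval, W) :=
  LinearMap.mkContinuous
    { toFun := fun γ => ⟨fun s => ∫ r in (0 : ℝ)..s, Set.IccExtend zero_le_one γ r,
        (intervalIntegral.continuous_primitive (fun a b =>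
          (γ.continuous.Icc_extend' (h := zero_le_one)).intervalIntegrable a b) 0).comp
            continuous_subtype_val⟩
      map_add' := fun γ γ' => by
        ext s
        exact intervalIntegral.integral_add
          ((γ.continuous.Icc_extend' (h := zero_le_one)).intervalIntegrable _ _)
          ((γ'.continuous.Icc_extend' (h := zero_le_one)).intervalIntegrable _ _)
      map_smul' := fun c γ => by
        ext s
        exact intervalIntegral.integral_smul c (Set.IccExtend zero_le_one γ) } 1
    (fun γ => by
      rw [ContinuousMap.norm_le _ (by positivity)]
      intro s
      have h := intervalIntegral.norm_integral_le_of_norm_le_const (a := 0) (b := s)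
        (f := Set.IccExtend zero_le_one γ) (C := ‖γ‖) (fun r _ => γ.norm_coe_le_norm _)
      refine h.trans ?_
      rw [one_mul, sub_zero, abs_of_nonneg s.2.1]
      exact mul_le_of_le_one_right (norm_nonneg _) s.2.2)

/-- The map that takes a point to the constant curve on the unit interval. -/
def constCurve (W : Type*) [NormedAddCommGroup W] [NormedSpace ℝ W] :
    W →L[ℝ] C(unitInterval, W) :=
  LinearMap.mkContinuous
    { toFun := ContinuousMap.const unitInterval
      map_add' := fun _ _ => rfl
      map_smul' := fun _ _ => rfl } 1
    (fun p => by
      rw [ContinuousMap.norm_le _ (by positivity)]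
      intro s
      exact (one_mul ‖p‖).ge)

variable {W : Type*} [NormedAddCommGroup W] [NormedSpace ℝ W]

theorem norm_primitive_le (γ : C(unitInterval, W)) : ‖primitive W γ‖ ≤ ‖γ‖ :=
  ((primitive W).le_of_opNorm_le (LinearMap.mkContinuous_norm_le _ zero_le_one _) γ).trans
    (one_mul _).le

@[simp]
theorem constCurve_apply (p : W) (s : unitInterval) : constCurve W p s = p := rfl

/-- The Picard map of the equation `γ' = t • f(γ)`, on the unit interval, is a contraction for small
`t`. -/
theorem lipschitzWith_picard {f : C(W, W)} {L : NNReal} (hL : LipschitzWith L f) {t : ℝ}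
    (ht : |t| * L ≤ 1 / 2) (p : W) :
    LipschitzWith 2⁻¹ fun γ : C(unitInterval, W) =>
      constCurve W p + t • primitive W (f.comp γ) := by
  refine LipschitzWith.of_dist_le_mul fun γ γ' => ?_
  have h1 : ‖f.comp γ - f.comp γ'‖ ≤ L * ‖γ - γ'‖ := by
    rw [ContinuousMap.norm_le _ (by positivity)]
    intro s
    refine (hL.norm_sub_le (γ s) (γ' s)).trans ?_
    gcongr
    exact (γ - γ').norm_coe_le_norm s
  rw [dist_eq_norm, dist_eq_norm, add_sub_add_left_eq_sub, ← smul_sub, ← map_sub, norm_smul,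
    Real.norm_eq_abs]
  calc |t| * ‖primitive W (f.comp γ - f.comp γ')‖ ≤ |t| * (L * ‖γ - γ'‖) := by
        gcongr
        exact (norm_primitive_le _).trans h1
    _ = |t| * L * ‖γ - γ'‖ := by ring
    _ ≤ 1 / 2 * ‖γ - γ'‖ := by gcongr
    _ = _ := by simp

/-- The smooth flow of a smooth, bounded and Lipschitz vector field `f`, for short times. To have
the time `t` as a parameter of a contraction on one fixed space, the solution is rescaled to the
unit interval: `z (t, p) s` stands for the solution with initial value `p` at the time `t s`. -/
theorem exists_flow [CompleteSpace W] {f : W → W} (hf : ContDiff ℝ ∞ f) {L : NNReal}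
    (hL : LipschitzWith L f) {C : ℝ} (hC : ∀ x, ‖f x‖ ≤ C) {ε : ℝ} (hε : 0 < ε)
    (hεL : ε * L ≤ 1 / 2) :
    ∃ Ψ : ℝ × W → W, ContDiffOn ℝ ∞ Ψ (Set.Ioo (-ε) ε ×ˢ Set.univ) ∧ (∀ p, Ψ (0, p) = p) ∧
      (∀ t ∈ Set.Ioo (-ε) ε, ∀ p, HasDerivAt (fun s => Ψ (s, p)) (f (Ψ (t, p))) t) ∧
      (∀ t ∈ Set.Ioo (-ε) ε, ∀ p, ‖Ψ (t, p) - p‖ ≤ C * |t|) ∧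
      (∀ t ∈ Set.Ioo (-ε) ε, ∀ p q,
        ‖(Ψ (t, p) - p) - (Ψ (t, q) - q)‖ ≤ 2 * L * |t| * ‖p - q‖) := by
  set fc : C(W, W) := ⟨f, hf.continuous⟩ with hfc
  set T : (ℝ × W) × C(unitInterval, W) → C(unitInterval, W) :=
    fun x => constCurve W x.1.2 + x.1.1 • primitive W (fc.comp x.2) with hT
  set U : Set (ℝ × W) := Set.Ioo (-ε) ε ×ˢ Set.univ with hU
  have hUo : IsOpen U := isOpen_Ioo.prod isOpen_univ
  have hlip : ∀ q ∈ U, LipschitzWith 2⁻¹ fun γ => T (q, γ) := by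
    intro q hq
    have hq' : |q.1| * L ≤ 1 / 2 :=
      (mul_le_mul_of_nonneg_right (abs_lt.2 hq.1).le L.2).trans hεL
    exact lipschitzWith_picard (f := fc) hL hq' q.2
  have hcon : ∀ q ∈ U, ContractingWith 2⁻¹ fun γ => T (q, γ) := fun q hq =>
    ⟨by rw [← NNReal.coe_lt_coe]; norm_num, hlip q hq⟩
  have hTs : ContDiff ℝ ∞ T := by
    have h1 : ContDiff ℝ ∞ fun x : (ℝ × W) × C(unitInterval, W) => fc.comp x.2 :=
      (contDiff_superposition fc hf).comp contDiff_snd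
    have h2 := (primitive W).contDiff.comp h1
    exact ((constCurve W).contDiff.comp (contDiff_snd.comp contDiff_fst)).add
      ((contDiff_fst.comp contDiff_fst).smul h2)
  have hex : ∀ q, ∃ γ, q ∈ U → T (q, γ) = γ := by
    intro q
    by_cases hq : q ∈ U
    · exact ⟨_, fun _ => (hcon q hq).fixedPoint_isFixedPt⟩
    · exact ⟨0, fun h => absurd h hq⟩
  choose z hz using hex
  have hzs : ∀ q ∈ U, ContDiffAt ℝ ∞ z q := fun q hq =>
    contDiffAt_fixedPoint (hUo.mem_nhds hq) hTs.contDiffAt hlip hz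
  have hzv : ∀ q ∈ U, ∀ s : unitInterval, z q s =
      q.2 + q.1 • ∫ r in (0 : ℝ)..s, Set.IccExtend zero_le_one (fc.comp (z q)) r := by
    intro q hq s
    conv_lhs => rw [← hz q hq]
    rfl
  set Ψ : ℝ × W → W := fun q => z q 1 with hΨ
  have hΨs : ContDiffOn ℝ ∞ Ψ U := fun q hq =>
    ((ContinuousMap.evalCLM (M := W) ℝ (1 : unitInterval)).contDiff.contDiffAt.comp q
      (hzs q hq)).contDiffWithinAt
  -- the solution for the time `t s` is the solution for the time `t`, slowed down by `s`
  have hscale : ∀ t ∈ Set.Ioo (-ε) ε, ∀ p, ∀ s : unitInterval, Ψ (t * s, p) = z (t, p) s := by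
    intro t ht p s
    have hts : ((t * s, p) : ℝ × W) ∈ U := by
      refine ⟨abs_lt.1 ?_, trivial⟩
      rw [abs_mul, abs_of_nonneg s.2.1]
      exact (mul_le_of_le_one_right (abs_nonneg _) s.2.2).trans_lt (abs_lt.2 ht)
    set γ : C(unitInterval, W) := ⟨fun r => z (t, p) (r * s), by fun_prop⟩ with hγ
    have hfix : T ((t * s, p), γ) = γ := by
      ext r
      change p + (t * s : ℝ) • (∫ u in (0 : ℝ)..r, Set.IccExtend zero_le_one (fc.comp γ) u) =
        z (t, p) (r * s)
      rw [hzv (t, p) ⟨ht, trivial⟩, mul_smul]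
      congr 2
      have h := intervalIntegral.smul_integral_comp_mul_left (a := 0) (b := r)
        (Set.IccExtend zero_le_one (fc.comp (z (t, p)))) (s : ℝ)
      rw [mul_zero] at h
      change _ = ∫ u in (0 : ℝ)..(r * s : ℝ), _
      rw [mul_comm (r : ℝ) s, ← h]
      congr 1
      refine intervalIntegral.integral_congr fun u hu => ?_
      rw [Set.uIcc_of_le r.2.1] at hu
      have hu' : u ∈ Set.Icc (0 : ℝ) 1 := ⟨hu.1, hu.2.trans r.2.2⟩
      have hsu : (s : ℝ) * u ∈ Set.Icc (0 : ℝ) 1 :=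
        ⟨mul_nonneg s.2.1 hu'.1, mul_le_one₀ s.2.2 hu'.1 hu'.2⟩
      simp only [Set.IccExtend_of_mem zero_le_one _ hu', Set.IccExtend_of_mem zero_le_one _ hsu]
      change f (z (t, p) _) = f (z (t, p) _)
      congr 2
      exact Subtype.ext (mul_comm _ _)
    have := (hcon _ hts).fixedPoint_unique' (hz _ hts) hfix
    rw [hΨ]
    simp only [this, hγ]
    change z (t, p) (1 * s) = _
    rw [one_mul]
  have hcont : ∀ p, ContinuousOn (fun s => f (Ψ (s, p))) (Set.Ioo (-ε) ε) := fun p =>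
    hf.continuous.comp_continuousOn (hΨs.continuousOn.comp (by fun_prop) fun s hs => ⟨hs, trivial⟩)
  have h0 : (0 : ℝ) ∈ Set.Ioo (-ε) ε := ⟨by linarith, hε⟩
  have hint : ∀ t ∈ Set.Ioo (-ε) ε, ∀ p, Ψ (t, p) = p + ∫ r in (0 : ℝ)..t, f (Ψ (r, p)) := by
    intro t ht p
    have h := intervalIntegral.smul_integral_comp_mul_left (a := 0) (b := 1)
      (fun r => f (Ψ (r, p))) t
    rw [mul_zero, mul_one] at h
    rw [← h]
    change z (t, p) 1 = _
    rw [hzv _ ⟨ht, trivial⟩]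
    change p + t • (∫ r in (0 : ℝ)..(1 : ℝ), _) = _
    congr 2
    refine intervalIntegral.integral_congr fun u hu => ?_
    rw [Set.uIcc_of_le zero_le_one] at hu
    simp only [Set.IccExtend_of_mem zero_le_one _ hu]
    change f (z (t, p) ⟨u, hu⟩) = _
    rw [← hscale t ht p ⟨u, hu⟩]
  refine ⟨Ψ, hΨs, fun p => ?_, fun t ht p => ?_, fun t ht p => ?_, fun t ht p q => ?_⟩
  · simpa using hint 0 h0 p
  · have hsub : Set.uIcc 0 t ⊆ Set.Ioo (-ε) ε := by
      intro s hs
      exact (Set.ordConnected_Ioo.uIcc_subset h0 ht) hs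
    have hd : HasDerivAt (fun s => p + ∫ r in (0 : ℝ)..s, f (Ψ (r, p))) (f (Ψ (t, p))) t :=
      (intervalIntegral.integral_hasDerivAt_right
        ((hcont p).mono hsub).intervalIntegrable
        ((hcont p).stronglyMeasurableAtFilter isOpen_Ioo t ht)
        ((hcont p).continuousAt (isOpen_Ioo.mem_nhds ht))).const_add p
    refine hd.congr_of_eventuallyEq ?_
    filter_upwards [isOpen_Ioo.mem_nhds ht] with s hs using hint s hs p
  · rw [hint t ht p, add_sub_cancel_left]
    simpa using intervalIntegral.norm_integral_le_of_norm_le_const (a := 0) (b := t)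
      (f := fun r => f (Ψ (r, p))) (C := C) (fun r _ => hC _)
  · have htp : ((t, p) : ℝ × W) ∈ U := ⟨ht, trivial⟩
    have htq : ((t, q) : ℝ × W) ∈ U := ⟨ht, trivial⟩
    -- two solution curves stay within twice the distance of their initial points
    have h1 : dist (z (t, p)) (z (t, q)) ≤ ‖p - q‖ / (1 - ((2⁻¹ : NNReal) : ℝ)) := by
      refine (hcon _ htp).dist_fixedPoint_fixedPoint_of_dist_le' (fun γ => T ((t, q), γ))
        (hz _ htp) (hz _ htq) fun γ => ?_
      rw [ContinuousMap.dist_le (norm_nonneg _)]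
      intro s
      simp [hT, dist_eq_norm]
    have h2 : ‖z (t, p) - z (t, q)‖ ≤ 2 * ‖p - q‖ := by
      rw [dist_eq_norm] at h1
      refine h1.trans (le_of_eq ?_)
      norm_num
      ring
    have h3 : ‖fc.comp (z (t, p)) - fc.comp (z (t, q))‖ ≤ L * (2 * ‖p - q‖) := by
      rw [ContinuousMap.norm_le _ (by positivity)]
      intro s
      refine (hL.norm_sub_le (z (t, p) s) (z (t, q) s)).trans ?_
      gcongr
      exact ((z (t, p) - z (t, q)).norm_coe_le_norm s).trans h2
    have h4 : (Ψ (t, p) - p) - (Ψ (t, q) - q) =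
        t • primitive W (fc.comp (z (t, p)) - fc.comp (z (t, q))) 1 := by
      have e1 : Ψ (t, p) = p + t • primitive W (fc.comp (z (t, p))) 1 := hzv _ htp 1
      have e2 : Ψ (t, q) = q + t • primitive W (fc.comp (z (t, q))) 1 := hzv _ htq 1
      rw [e1, e2, add_sub_cancel_left, add_sub_cancel_left, ← smul_sub, map_sub]
      rfl
    rw [h4, norm_smul, Real.norm_eq_abs]
    calc _ ≤ |t| * (L * (2 * ‖p - q‖)) := by
          gcongr
          exact ((ContinuousMap.norm_coe_le_norm _ _).trans (norm_primitive_le _)).trans h3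
      _ = _ := by ring

end Flow

/-! ### Hamiltonian vectors in canonical coordinates -/

section HamVec

/-- The space `ℝ^n` of positions, that is, of coordinates on the base. -/
abbrev Pos (n : ℕ) : Type := EuclideanSpace ℝ (Fin n)

/-- The space of canonical coordinates `(x, η)`. -/
abbrev PhaseSpace (n : ℕ) : Type := Pos n × (Pos n →L[ℝ] ℝ)

variable {n : ℕ}

/-- The linear isomorphism `ξ ↦ ⟪ξ, ·⟫` from `ℝ^n` to its dual. -/
def covec (n : ℕ) : Pos n ≃L[ℝ] (Pos n →L[ℝ] ℝ) :=
  LinearEquiv.toContinuousLinearEquiv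
    { toFun := fun ξ => innerSL ℝ ξ
      map_add' := fun _ _ => map_add _ _ _
      map_smul' := fun c ξ => by simp
      invFun := (InnerProductSpace.toDual ℝ (Pos n)).symm
      left_inv := fun ξ => (InnerProductSpace.toDual ℝ (Pos n)).symm_apply_apply ξ
      right_inv := fun η => (InnerProductSpace.toDual ℝ (Pos n)).apply_symm_apply η }

@[simp]
theorem covec_apply (ξ v : Pos n) : covec n ξ v = inner ℝ ξ v := rfl

@[simp]
theorem norm_covec (ξ : Pos n) : ‖covec n ξ‖ = ‖ξ‖ := innerSL_apply_norm ℝ ξ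

/-- The isomorphism from the covectors to the vectors of phase space that the canonical symplectic
form `ω` induces: it takes `ω(X, ·)` to `X`. -/
def symplecticDual (n : ℕ) : (PhaseSpace n →L[ℝ] ℝ) →L[ℝ] PhaseSpace n :=
  LinearMap.toContinuousLinearMap
    { toFun := fun L : PhaseSpace n →L[ℝ] ℝ =>
        ((covec n).symm ((L ∘L .inr ℝ (Pos n) (Pos n →L[ℝ] ℝ)) ∘L
          (covec n : Pos n →L[ℝ] Pos n →L[ℝ] ℝ)), -(L ∘L .inl ℝ (Pos n) (Pos n →L[ℝ] ℝ)))
      map_add' := fun L L' => by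
        ext1
        · simp [ContinuousLinearMap.add_comp]
        · simp [ContinuousLinearMap.add_comp, add_comm]
      map_smul' := fun c L => by
        ext1 <;> simp [ContinuousLinearMap.smul_comp] }

theorem canonicalSymplectic_symplecticDual (L : PhaseSpace n →L[ℝ] ℝ) (v : PhaseSpace n) :
    canonicalSymplectic (symplecticDual n L) v = L v := by
  obtain ⟨a, η⟩ := v
  obtain ⟨ξ, rfl⟩ := (covec n).surjective η
  have h : covec n ξ (symplecticDual n L).1 = L (0, covec n ξ) := by
    change inner ℝ ξ ((covec n).symm ((L ∘L .inr ℝ _ _) ∘L (covec n : Pos n →L[ℝ] _))) = _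
    rw [real_inner_comm, ← covec_apply, ContinuousLinearEquiv.apply_symm_apply]
    simp
  have h' : (symplecticDual n L).2 a = - L (a, 0) := by
    change (-(L ∘L .inl ℝ _ _)) a = _
    simp
  change covec n ξ (symplecticDual n L).1 - (symplecticDual n L).2 a = _
  rw [h, h', sub_neg_eq_add, ← map_add]
  simp

theorem eq_of_canonicalSymplectic {X X' : PhaseSpace n}
    (h : ∀ v, canonicalSymplectic X v = canonicalSymplectic X' v) : X = X' := by
  simp only [canonicalSymplectic] at h
  ext1
  · refine ext_inner_left ℝ fun ξ => ?_
    simpa using h (0, covec n ξ)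
  · ext a
    simpa using h (a, 0)

/-- The Hamiltonian vector field of `H`, in canonical coordinates. -/
def hamVec (H : PhaseSpace n → ℝ) (z : PhaseSpace n) : PhaseSpace n :=
  symplecticDual n (fderiv ℝ H z)

theorem canonicalSymplectic_hamVec (H : PhaseSpace n → ℝ) (z v : PhaseSpace n) :
    canonicalSymplectic (hamVec H z) v = fderiv ℝ H z v :=
  canonicalSymplectic_symplecticDual _ _

theorem isHamiltonianVector_iff {H : PhaseSpace n → ℝ} {z X : PhaseSpace n} :
    IsHamiltonianVector H z X ↔ X = hamVec H z := by
  refine ⟨fun h => eq_of_canonicalSymplectic fun v => ?_, fun h v => ?_⟩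
  · rw [← h v, canonicalSymplectic_hamVec]
  · rw [h, canonicalSymplectic_hamVec]

theorem contDiffOn_hamVec {H : PhaseSpace n → ℝ} {Ω : Set (PhaseSpace n)} (hΩ : IsOpen Ω)
    (hH : ContDiffOn ℝ ∞ H Ω) : ContDiffOn ℝ ∞ (hamVec H) Ω :=
  (symplecticDual n).contDiff.comp_contDiffOn (hH.fderiv_of_isOpen hΩ (by simp))

/-- The Hamiltonian vector field of a homogeneous function commutes with the dilations of the
fibres. -/
theorem hamVec_smul {H : PhaseSpace n → ℝ} {z : PhaseSpace n} {l : ℝ} (hl : l ≠ 0)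
    (hd : DifferentiableAt ℝ H z) (hd' : DifferentiableAt ℝ H (z.1, l • z.2))
    (hom : ∀ᶠ z' in 𝓝 z, H (z'.1, l • z'.2) = l * H z') :
    hamVec H (z.1, l • z.2) = ((hamVec H z).1, l • (hamVec H z).2) := by
  set S : PhaseSpace n →L[ℝ] PhaseSpace n := (ContinuousLinearMap.fst ℝ _ _).prod
    (l • ContinuousLinearMap.snd ℝ _ _) with hS
  have hSa : ∀ u, S u = (u.1, l • u.2) := fun u => rfl
  have h1 : HasFDerivAt (fun z' => H (S z')) (fderiv ℝ H (z.1, l • z.2) ∘L S) z :=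
    HasFDerivAt.comp z (f := S) (by rw [hSa]; exact hd'.hasFDerivAt) S.hasFDerivAt
  have h2 : HasFDerivAt (fun z' => H (S z')) (l • fderiv ℝ H z) z :=
    (hd.hasFDerivAt.const_mul l).congr_of_eventuallyEq hom
  have h3 := h1.unique h2
  refine eq_of_canonicalSymplectic fun v => ?_
  have h4 : v = S (v.1, l⁻¹ • v.2) := by simp [hSa, smul_smul, mul_inv_cancel₀ hl]
  have h5 := congrArg (fun L => L (v.1, l⁻¹ • v.2)) h3
  simp only [ContinuousLinearMap.comp_apply, ← h4, _root_.smul_apply,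
    ← canonicalSymplectic_hamVec] at h5
  rw [h5]
  simp only [canonicalSymplectic, _root_.smul_apply, smul_eq_mul]
  field_simp

/-- Euler's identity: `η · ∂H/∂η = H`. -/
theorem apply_hamVec_fst {H : PhaseSpace n → ℝ} {z : PhaseSpace n} (hd : DifferentiableAt ℝ H z)
    (hom : ∀ l : ℝ, 0 < l → H (z.1, l • z.2) = l * H z) : z.2 (hamVec H z).1 = H z := by
  have h1 : HasDerivAt (fun l : ℝ => ((z.1, l • z.2) : PhaseSpace n)) (0, z.2) 1 := by
    have := (hasDerivAt_const (1 : ℝ) z.1).prodMk ((hasDerivAt_id (1 : ℝ)).smul_const z.2)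
    simpa using this
  have h2 : HasDerivAt (fun l : ℝ => H (z.1, l • z.2)) (fderiv ℝ H z (0, z.2)) 1 := by
    refine HasFDerivAt.comp_hasDerivAt (1 : ℝ) (l := H) ?_ h1
    rw [one_smul]
    exact hd.hasFDerivAt
  have h3 : HasDerivAt (fun l : ℝ => H (z.1, l • z.2)) (H z) 1 := by
    have : HasDerivAt (fun l : ℝ => l * H z) (1 * H z) 1 := (hasDerivAt_id (1 : ℝ)).mul_const _
    rw [one_mul] at this
    refine this.congr_of_eventuallyEq ?_
    filter_upwards [lt_mem_nhds (zero_lt_one (α := ℝ))] with l hl using hom l hl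
  rw [← h2.unique h3, ← canonicalSymplectic_hamVec]
  simp [canonicalSymplectic]

/-- Conservation of energy. -/
theorem hasDerivAt_energy {H : PhaseSpace n → ℝ} {γ : ℝ → PhaseSpace n} {t : ℝ}
    (hd : DifferentiableAt ℝ H (γ t)) (hγ : HasDerivAt γ (hamVec H (γ t)) t) :
    HasDerivAt (fun s => H (γ s)) 0 t := by
  have h := HasFDerivAt.comp_hasDerivAt t hd.hasFDerivAt hγ
  rw [← canonicalSymplectic_hamVec] at h
  exact h.congr_deriv (by simp [canonicalSymplectic])

/-- The flow of a homogeneous Hamiltonian preserves the Liouville form `∑ j, η_j dx_j`: by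
Hamilton's equations the derivative of `η · δx` is `-∂H/∂x · δx + η · δ(∂H/∂η)`, and this vanishes
by the variation in the direction `δ` of Euler's identity `η · ∂H/∂η = H`. -/
theorem hasDerivAt_liouville {Q : Type*} [NormedAddCommGroup Q] [NormedSpace ℝ Q]
    {H : PhaseSpace n → ℝ} {Ω : Set (PhaseSpace n)} (hΩ : IsOpen Ω) (hH : DifferentiableOn ℝ H Ω)
    (hom : ∀ z ∈ Ω, ∀ l : ℝ, 0 < l → H (z.1, l • z.2) = l * H z)
    {Z : ℝ × Q → PhaseSpace n} {t : ℝ} {q : Q} (hZ : ContDiffAt ℝ ∞ Z (t, q))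
    (hZΩ : ∀ᶠ x in 𝓝 (t, q), Z x ∈ Ω)
    (hZd : ∀ᶠ x in 𝓝 (t, q), HasDerivAt (fun s => Z (s, x.2)) (hamVec H (Z x)) x.1) (δ : Q) :
    HasDerivAt (fun s => (Z (s, q)).2 (fderiv ℝ Z (s, q) (0, δ)).1) 0 t := by
  have hF : ContDiffAt ℝ ∞ (fderiv ℝ Z) (t, q) := hZ.fderiv_right (by simp)
  have hFd : HasFDerivAt (fderiv ℝ Z) (fderiv ℝ (fderiv ℝ Z) (t, q)) (t, q) :=
    (hF.differentiableAt (by simp)).hasFDerivAt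
  set D2 := fderiv ℝ (fderiv ℝ Z) (t, q) with hD2
  have hsymm : D2 (1, 0) (0, δ) = D2 (0, δ) (1, 0) :=
    (hZ.isSymmSndFDerivAt (by
      rw [minSmoothness_of_isRCLikeNormedField]
      exact WithTop.coe_le_coe.2 (le_top : (2 : ℕ∞) ≤ ⊤))).eq _ _
  have hdiff : ∀ᶠ x in 𝓝 (t, q), DifferentiableAt ℝ Z x := by
    have := (hZ.of_le (m := 1) (by simp)).eventually (by simp)
    exact this.mono fun x hx => hx.differentiableAt (by simp)
  -- the time derivative is the Hamiltonian vector field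
  have hvel : ∀ᶠ x in 𝓝 (t, q), fderiv ℝ Z x (1, 0) = hamVec H (Z x) := by
    filter_upwards [hdiff, hZd] with x hx hx'
    have h1 : HasDerivAt (fun s : ℝ => ((s, x.2) : ℝ × Q)) (1, 0) x.1 :=
      (hasDerivAt_id x.1).prodMk (hasDerivAt_const _ _)
    exact (HasFDerivAt.comp_hasDerivAt x.1 (l := Z) hx.hasFDerivAt h1).unique hx'
  have hcurve : HasDerivAt (fun s : ℝ => ((s, q) : ℝ × Q)) (1, 0) t :=
    (hasDerivAt_id t).prodMk (hasDerivAt_const _ _)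
  have hv : HasDerivAt (fun s => fderiv ℝ Z (s, q) (0, δ)) (D2 (1, 0) (0, δ)) t := by
    have := HasFDerivAt.comp_hasDerivAt t (l := fderiv ℝ Z) hFd hcurve
    exact this.clm_apply (hasDerivAt_const t ((0, δ) : ℝ × Q)) |>.congr_deriv (by simp)
  have hZt := hZd.self_of_nhds
  simp only at hZt
  -- Euler's identity, differentiated in the direction `δ`
  set v := fderiv ℝ Z (t, q) (0, δ) with hv_def
  have hline : HasDerivAt (fun s : ℝ => ((t, q + s • δ) : ℝ × Q)) (0, δ) 0 := by
    have := (hasDerivAt_const (0 : ℝ) t).prodMk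
      (((hasDerivAt_id (0 : ℝ)).smul_const δ).const_add q)
    simpa using this
  have hline0 : ((t, q + (0 : ℝ) • δ) : ℝ × Q) = (t, q) := by simp
  have hZl : HasDerivAt (fun s : ℝ => Z (t, q + s • δ)) v 0 := by
    refine HasFDerivAt.comp_hasDerivAt (0 : ℝ) (l := Z) ?_ hline
    rw [hline0]
    exact hdiff.self_of_nhds.hasFDerivAt
  have hFl : HasDerivAt (fun s : ℝ => fderiv ℝ Z (t, q + s • δ) (1, 0)) (D2 (0, δ) (1, 0)) 0 := by
    have : HasDerivAt (fun s : ℝ => fderiv ℝ Z (t, q + s • δ)) (D2 (0, δ)) 0 := by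
      refine HasFDerivAt.comp_hasDerivAt (0 : ℝ) (l := fderiv ℝ Z) ?_ hline
      rw [hline0]
      exact hFd
    exact this.clm_apply (hasDerivAt_const (0 : ℝ) ((1, 0) : ℝ × Q)) |>.congr_deriv (by simp)
  have hcont : Filter.Tendsto (fun s : ℝ => ((t, q + s • δ) : ℝ × Q)) (𝓝 0) (𝓝 (t, q)) := by
    have := hline.continuousAt.tendsto
    rwa [hline0] at this
  have hHd : HasFDerivAt H (fderiv ℝ H (Z (t, q))) (Z (t, q)) :=
    (hH.differentiableAt (hΩ.mem_nhds hZΩ.self_of_nhds)).hasFDerivAt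
  have e1 : HasDerivAt (fun s : ℝ => H (Z (t, q + s • δ))) (fderiv ℝ H (Z (t, q)) v) 0 := by
    refine HasFDerivAt.comp_hasDerivAt (0 : ℝ) (l := H) ?_ hZl
    rw [hline0]
    exact hHd
  have e2 : HasDerivAt (fun s : ℝ => H (Z (t, q + s • δ)))
      (v.2 (fderiv ℝ Z (t, q) (1, 0)).1 + (Z (t, q)).2 (D2 (0, δ) (1, 0)).1) 0 := by
    have h2 : HasDerivAt (fun s : ℝ => (Z (t, q + s • δ)).2) v.2 0 := hZl.snd
    have h1 : HasDerivAt (fun s : ℝ => (fderiv ℝ Z (t, q + s • δ) (1, 0)).1)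
      (D2 (0, δ) (1, 0)).1 0 := hFl.fst
    have h := h2.clm_apply h1
    rw [hline0] at h
    refine h.congr_of_eventuallyEq ?_
    filter_upwards [hcont.eventually hvel, hcont.eventually hZΩ] with s hs hs'
    simp only [hs]
    exact (apply_hamVec_fst (hH.differentiableAt (hΩ.mem_nhds hs')) (hom _ hs')).symm
  have key := e1.unique e2
  rw [hvel.self_of_nhds, ← canonicalSymplectic_hamVec] at key
  simp only [canonicalSymplectic] at key
  have h2 : HasDerivAt (fun s => (Z (s, q)).2) (hamVec H (Z (t, q))).2 t := hZt.snd
  have h1 : HasDerivAt (fun s => (fderiv ℝ Z (s, q) (0, δ)).1) (D2 (1, 0) (0, δ)).1 t := hv.fst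
  refine (h2.clm_apply h1).congr_deriv ?_
  rw [hsymm]
  linarith

end HamVec

/-! ### The local flow of a homogeneous Hamiltonian -/

section LocalFlow

variable {n : ℕ}

/-- A smooth function with prescribed support that equals one near a compact set. -/
theorem exists_cutoff {W : Type*} [NormedAddCommGroup W] [NormedSpace ℝ W] [FiniteDimensional ℝ W]
    {K Ω : Set W} (hK : IsCompact K) (hΩ : IsOpen Ω) (hKΩ : K ⊆ Ω) :
    ∃ (χ : W → ℝ) (t : Set W) (δ : ℝ), ContDiff ℝ ∞ χ ∧ IsCompact t ∧ t ⊆ Ω ∧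
      (∀ z ∉ t, χ z = 0) ∧ 0 < δ ∧ ∀ z ∈ Metric.thickening δ K, χ z = 1 := by
  have : ProperSpace W := FiniteDimensional.proper_real W
  obtain ⟨δ, hδ, hδΩ⟩ := hK.exists_cthickening_subset_open hΩ hKΩ
  obtain ⟨χ, h1, h2, -⟩ := exists_contMDiffMap_one_nhds_of_subset_interior 𝓘(ℝ, W) (n := ⊤)
    (s := K) (t := Metric.cthickening δ K) hK.isClosed
    ((Metric.self_subset_thickening hδ K).trans (interior_maximal
      (Metric.thickening_subset_cthickening δ K) Metric.isOpen_thickening))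
  obtain ⟨U, hU, hKU, hU1⟩ := mem_nhdsSet_iff_exists.1 h1
  obtain ⟨δ', hδ', hδU⟩ := hK.exists_thickening_subset_open hU hKU
  exact ⟨χ, _, δ', χ.contMDiff.contDiff, hK.cthickening, hδΩ, h2, hδ', fun z hz => hU1 (hδU hz)⟩

theorem contDiffAt_normalize {ξ : Pos n} (hξ : ξ ≠ 0) :
    ContDiffAt ℝ ∞ (fun ξ : Pos n => ‖ξ‖⁻¹ • ξ) ξ :=
  ((contDiffAt_norm ℝ hξ).inv (norm_ne_zero_iff.2 hξ)).smul contDiffAt_id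

/-- `H` is a smooth function on the nonzero covectors over the open set `O`, positively homogeneous
of degree one in the fibres. -/
structure IsHomogeneousHamiltonian (O : Set (Pos n)) (H : PhaseSpace n → ℝ) : Prop where
  isOpen : IsOpen O
  contDiffOn : ContDiffOn ℝ ∞ H (O ×ˢ {0}ᶜ)
  homogeneous : ∀ z ∈ O ×ˢ ({0}ᶜ : Set (Pos n →L[ℝ] ℝ)), ∀ l : ℝ, 0 < l →
    H (z.1, l • z.2) = l * H z

namespace IsHomogeneousHamiltonian

variable {O : Set (Pos n)} {H : PhaseSpace n → ℝ}

theorem isOpen_prod (hH : IsHomogeneousHamiltonian O H) :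
    IsOpen (O ×ˢ ({0}ᶜ : Set (Pos n →L[ℝ] ℝ))) :=
  hH.isOpen.prod isOpen_compl_singleton

theorem differentiableAt (hH : IsHomogeneousHamiltonian O H) {z : PhaseSpace n}
    (hz : z ∈ O ×ˢ ({0}ᶜ : Set (Pos n →L[ℝ] ℝ))) : DifferentiableAt ℝ H z :=
  (hH.contDiffOn.contDiffAt (hH.isOpen_prod.mem_nhds hz)).differentiableAt (by simp)

end IsHomogeneousHamiltonian

/-- `Z (t, y, ξ)` is, for `|t| < ε`, the Hamiltonian flow of the homogeneous function `H` on
`O × (ℝ^n ∖ 0)` with the initial value `(y, ⟪ξ, ·⟫)`, for `y` within `2 r` of `x₀`. The base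
component is within `r` of `y`, differs from `y` by a contraction and is constant on the rays
`{l • ξ | l > 0}`. For the other `y` the function `Z` need not be related to `H`, but keeps the
last properties, so that `y ↦ (Z (t, y, ξ)).1` is a diffeomorphism of the whole of `ℝ^n`. -/
structure IsLocalFlow (O : Set (Pos n)) (H : PhaseSpace n → ℝ) (x₀ : Pos n) (r ε : ℝ)
    (Z : ℝ × Pos n × Pos n → PhaseSpace n) : Prop where
  r_pos : 0 < r
  ε_pos : 0 < ε
  contDiffOn : ContDiffOn ℝ ∞ Z (Set.Ioo (-ε) ε ×ˢ Set.univ ×ˢ {0}ᶜ)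
  initial : ∀ y ξ, ξ ≠ 0 → Z (0, y, ξ) = (y, covec n ξ)
  mem : ∀ t ∈ Set.Ioo (-ε) ε, ∀ y ∈ Metric.ball x₀ (2 * r), ∀ ξ, ξ ≠ 0 →
    Z (t, y, ξ) ∈ O ×ˢ ({0}ᶜ : Set (Pos n →L[ℝ] ℝ))
  hasDerivAt : ∀ t ∈ Set.Ioo (-ε) ε, ∀ y ∈ Metric.ball x₀ (2 * r), ∀ ξ, ξ ≠ 0 →
    HasDerivAt (fun s => Z (s, y, ξ)) (hamVec H (Z (t, y, ξ))) t
  ray : ∀ t y ξ, ∀ l : ℝ, 0 < l → (Z (t, y, l • ξ)).1 = (Z (t, y, ξ)).1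
  lipschitz : ∀ t ∈ Set.Ioo (-ε) ε, ∀ ξ, LipschitzWith 2⁻¹ fun y => (Z (t, y, ξ)).1 - y
  near : ∀ t ∈ Set.Ioo (-ε) ε, ∀ y ξ, ‖(Z (t, y, ξ)).1 - y‖ ≤ r

/-- A homogeneous Hamiltonian has a local flow over a neighbourhood of each point, for a time that
does not depend on the covector. The vector field is cut off outside a neighbourhood of the unit
sphere over `x₀`, so that it becomes bounded and Lipschitz, and the flow of a covector `ξ` is that
of `ξ / ‖ξ‖`, scaled by `‖ξ‖`. -/
theorem exists_isLocalFlow {O : Set (Pos n)} {H : PhaseSpace n → ℝ}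
    (hHam : IsHomogeneousHamiltonian O H) {x₀ : Pos n} (hx₀ : x₀ ∈ O) :
    ∃ (r ε : ℝ) (Z : ℝ × Pos n × Pos n → PhaseSpace n), IsLocalFlow O H x₀ r ε Z := by
  set Ω : Set (PhaseSpace n) := O ×ˢ {0}ᶜ with hΩdef
  have hΩ : IsOpen Ω := hHam.isOpen_prod
  have hprop : ProperSpace (Pos n →L[ℝ] ℝ) := FiniteDimensional.proper_real _
  set K : Set (PhaseSpace n) := {x₀} ×ˢ Metric.sphere 0 1 with hKdef
  have hK : IsCompact K := isCompact_singleton.prod (isCompact_sphere _ _)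
  have hKΩ : K ⊆ Ω := by
    rintro ⟨x, η⟩ ⟨hx, hη⟩
    refine ⟨?_, fun h => ?_⟩
    · rw [Set.mem_singleton_iff.1 hx]; exact hx₀
    · rw [Set.mem_singleton_iff] at h
      simp only at h hη
      rw [h] at hη
      simp at hη
  obtain ⟨χ, T, δ, hχ, hT, hTΩ, hχ0, hδ, hχ1⟩ := exists_cutoff hK hΩ hKΩ
  set f : PhaseSpace n → PhaseSpace n := fun z => χ z • hamVec H z with hfdef
  have hX := contDiffOn_hamVec hΩ hHam.contDiffOn
  have hf : ContDiff ℝ ∞ f := by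
    rw [contDiff_iff_contDiffAt]
    intro z
    by_cases hz : z ∈ T
    · exact hχ.contDiffAt.smul (hX.contDiffAt (hΩ.mem_nhds (hTΩ hz)))
    · refine (contDiffAt_const (c := (0 : PhaseSpace n))).congr_of_eventuallyEq ?_
      filter_upwards [hT.isClosed.isOpen_compl.mem_nhds hz] with z' hz'
      simp [hfdef, hχ0 z' hz']
  have hfs : HasCompactSupport f := HasCompactSupport.intro hT fun z hz => by
    simp [hfdef, hχ0 z hz]
  obtain ⟨L, hL⟩ := hf.lipschitzWith_of_hasCompactSupport hfs (by simp)
  obtain ⟨C, hC⟩ := hfs.exists_bound_of_continuous hf.continuous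
  have hC0 : 0 ≤ C := (norm_nonneg _).trans (hC 0)
  set r : ℝ := δ / 3 with hr
  have hr0 : 0 < r := by positivity
  -- `ε L ≤ 1 / 4` makes `y ↦ X - y` Lipschitz with the constant `1 / 2`, and `C ε ≤ r` bounds it
  set ε : ℝ := min (1 / (4 * (L + 1))) (r / (C + 1)) with hεdef
  have hL0 : (0 : ℝ) ≤ L := L.2
  have hε : 0 < ε := lt_min (by positivity) (by positivity)
  have hεL : ε * L ≤ 1 / 4 := by
    have h : ε * (4 * (L + 1)) ≤ 1 :=
      (le_div_iff₀ (by positivity)).1 (min_le_left (1 / (4 * ((L : ℝ) + 1))) (r / (C + 1)))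
    nlinarith
  have hεC : C * ε ≤ r := by
    have h : ε * (C + 1) ≤ r :=
      (le_div_iff₀ (by positivity)).1 (min_le_right (1 / (4 * ((L : ℝ) + 1))) (r / (C + 1)))
    nlinarith
  obtain ⟨Ψ, hΨs, hΨ0, hΨd, hΨC, hΨL⟩ := exists_flow hf hL hC hε (by linarith)
  have hΨr : ∀ t ∈ Set.Ioo (-ε) ε, ∀ p, ‖Ψ (t, p) - p‖ ≤ r := fun t ht p =>
    (hΨC t ht p).trans ((mul_le_mul_of_nonneg_left (abs_lt.2 ht).le hC0).trans hεC)
  -- the initial value, normalized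
  set p : Pos n → Pos n → PhaseSpace n := fun y ξ => (y, covec n (‖ξ‖⁻¹ • ξ)) with hp
  have hflow : ∀ t ∈ Set.Ioo (-ε) ε, ∀ y ∈ Metric.ball x₀ (2 * r), ∀ ξ, ξ ≠ 0 →
      ((Ψ (t, p y ξ)).1, ‖ξ‖ • (Ψ (t, p y ξ)).2) ∈ Ω ∧
        HasDerivAt (fun s => ((Ψ (s, p y ξ)).1, ‖ξ‖ • (Ψ (s, p y ξ)).2))
          (hamVec H ((Ψ (t, p y ξ)).1, ‖ξ‖ • (Ψ (t, p y ξ)).2)) t := by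
    intro t ht y hy ξ hξ
    have hn : 0 < ‖ξ‖ := norm_pos_iff.2 hξ
    -- the curve stays where the cutoff function is one: `r + 2 r = δ`
    have hthick : Ψ (t, p y ξ) ∈ Metric.thickening δ K := by
      rw [Metric.mem_thickening_iff]
      refine ⟨(x₀, covec n (‖ξ‖⁻¹ • ξ)), ⟨rfl, ?_⟩, ?_⟩
      · simp [norm_smul, hn.ne']
      · have h1 : dist (Ψ (t, p y ξ)) (p y ξ) ≤ r := by rw [dist_eq_norm]; exact hΨr t ht _
        have h2 : dist (p y ξ) (x₀, covec n (‖ξ‖⁻¹ • ξ)) < 2 * r := by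
          simpa [hp, Prod.dist_eq, hr0] using hy
        have := dist_triangle (Ψ (t, p y ξ)) (p y ξ) (x₀, covec n (‖ξ‖⁻¹ • ξ))
        rw [hr] at h1 h2
        linarith
    have hone := hχ1 _ hthick
    have hmem : Ψ (t, p y ξ) ∈ Ω := by
      apply hTΩ
      by_contra h
      rw [hχ0 _ h] at hone
      exact zero_ne_one hone
    have hmem' : ((Ψ (t, p y ξ)).1, ‖ξ‖ • (Ψ (t, p y ξ)).2) ∈ Ω :=
      ⟨hmem.1, smul_ne_zero hn.ne' hmem.2⟩
    refine ⟨hmem', ?_⟩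
    have hd := hΨd t ht (p y ξ)
    simp only [hfdef, hone, one_smul] at hd
    rw [hamVec_smul hn.ne' (hHam.differentiableAt hmem)
      (hHam.differentiableAt hmem')]
    · have hd1 : HasDerivAt (fun s => (Ψ (s, p y ξ)).1) (hamVec H (Ψ (t, p y ξ))).1 t := hd.fst
      have hd2 : HasDerivAt (fun s => (Ψ (s, p y ξ)).2) (hamVec H (Ψ (t, p y ξ))).2 t := hd.snd
      have hd3 : HasDerivAt (fun s => ‖ξ‖ • (Ψ (s, p y ξ)).2)
        (‖ξ‖ • (hamVec H (Ψ (t, p y ξ))).2) t := hd2.const_smul ‖ξ‖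
      exact hd1.prodMk hd3
    · filter_upwards [hΩ.mem_nhds hmem] with z hz using hHam.homogeneous z hz _ hn
  refine ⟨r, ε, fun q => ((Ψ (q.1, p q.2.1 q.2.2)).1, ‖q.2.2‖ • (Ψ (q.1, p q.2.1 q.2.2)).2),
    hr0, hε, ?_, ?_, ?_, ?_, ?_, ?_, ?_⟩
  · rintro ⟨t, y, ξ⟩ ⟨ht, -, hξ⟩
    have hξ' : ξ ≠ 0 := hξ
    have hin : ContDiffAt ℝ ∞ (fun q : ℝ × Pos n × Pos n => (q.1, p q.2.1 q.2.2)) (t, y, ξ) := by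
      have h1 : ContDiffAt ℝ ∞ (fun q : ℝ × Pos n × Pos n => ‖q.2.2‖⁻¹ • q.2.2) (t, y, ξ) :=
        ContDiffAt.comp (t, y, ξ) (g := fun ξ : Pos n => ‖ξ‖⁻¹ • ξ)
          (f := fun q : ℝ × Pos n × Pos n => q.2.2) (contDiffAt_normalize hξ') (by fun_prop)
      exact contDiffAt_fst.prodMk ((contDiffAt_fst.comp _ contDiffAt_snd).prodMk
        ((covec n).contDiff.contDiffAt.comp _ h1))
    have hΨat : ContDiffAt ℝ ∞ Ψ (t, p y ξ) :=
      hΨs.contDiffAt ((isOpen_Ioo.prod isOpen_univ).mem_nhds ⟨ht, trivial⟩)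
    have hcomp : ContDiffAt ℝ ∞ (fun q : ℝ × Pos n × Pos n => Ψ (q.1, p q.2.1 q.2.2)) (t, y, ξ) :=
      ContDiffAt.comp (t, y, ξ) hΨat hin
    have hnorm : ContDiffAt ℝ ∞ (fun q : ℝ × Pos n × Pos n => ‖q.2.2‖) (t, y, ξ) :=
      ContDiffAt.comp (t, y, ξ) (g := fun ξ : Pos n => ‖ξ‖)
        (f := fun q : ℝ × Pos n × Pos n => q.2.2) (contDiffAt_norm ℝ hξ') (by fun_prop)
    exact (hcomp.fst.prodMk (hnorm.smul hcomp.snd)).contDiffWithinAt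
  · intro y ξ hξ
    simp only [hΨ0, hp]
    rw [map_smul, smul_smul, mul_inv_cancel₀ (norm_ne_zero_iff.2 hξ), one_smul]
  · exact fun t ht y hy ξ hξ => (hflow t ht y hy ξ hξ).1
  · exact fun t ht y hy ξ hξ => (hflow t ht y hy ξ hξ).2
  · intro t y ξ l hl
    have h : ‖l • ξ‖⁻¹ • l • ξ = ‖ξ‖⁻¹ • ξ := by
      rw [norm_smul, Real.norm_eq_abs, abs_of_pos hl, smul_smul, mul_inv, mul_comm l⁻¹, mul_assoc,
        inv_mul_cancel₀ hl.ne', mul_one]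
    simp only [hp, h]
  · intro t ht ξ
    refine LipschitzWith.of_dist_le_mul fun y y' => ?_
    have h1 := hΨL t ht (p y ξ) (p y' ξ)
    have h2 : ‖p y ξ - p y' ξ‖ = ‖y - y'‖ := by simp [hp, Prod.norm_def]
    rw [dist_eq_norm, dist_eq_norm]
    refine (norm_fst_le ((Ψ (t, p y ξ) - p y ξ) - (Ψ (t, p y' ξ) - p y' ξ))).trans
      (h1.trans ?_)
    rw [h2]
    refine mul_le_mul_of_nonneg_right ?_ (norm_nonneg _)
    have : |t| * L ≤ 1 / 4 := (mul_le_mul_of_nonneg_right (abs_lt.2 ht).le hL0).trans hεL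
    simp only [NNReal.coe_inv, NNReal.coe_ofNat]
    linarith
  · intro t ht y ξ
    exact (norm_fst_le (Ψ (t, p y ξ) - p y ξ)).trans (hΨr t ht _)

end LocalFlow

/-! ### The inverse of the base component of the flow, and the phase in coordinates -/

namespace IsLocalFlow

variable {n : ℕ} {O : Set (Pos n)} {H : PhaseSpace n → ℝ} {x₀ : Pos n} {r ε : ℝ}
  {Z : ℝ × Pos n × Pos n → PhaseSpace n}

theorem zero_mem (h : IsLocalFlow O H x₀ r ε Z) : (0 : ℝ) ∈ Set.Ioo (-ε) ε :=
  ⟨neg_lt_zero.2 h.ε_pos, h.ε_pos⟩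

theorem neg_mem_Ioo {t : ℝ} (ht : t ∈ Set.Ioo (-ε) ε) : -t ∈ Set.Ioo (-ε) ε :=
  ⟨neg_lt_neg ht.2, neg_lt.1 ht.1⟩

theorem isOpen_dom (n : ℕ) (ε : ℝ) :
    IsOpen (Set.Ioo (-ε) ε ×ˢ Set.univ ×ˢ {0}ᶜ : Set (ℝ × Pos n × Pos n)) :=
  isOpen_Ioo.prod (isOpen_univ.prod isOpen_compl_singleton)

theorem contDiffAt (h : IsLocalFlow O H x₀ r ε Z) {t : ℝ} (ht : t ∈ Set.Ioo (-ε) ε) (y : Pos n)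
    {ξ : Pos n} (hξ : ξ ≠ 0) : ContDiffAt ℝ ∞ Z (t, y, ξ) :=
  h.contDiffOn.contDiffAt ((isOpen_dom n ε).mem_nhds ⟨ht, trivial, hξ⟩)

theorem hasFDerivAt (h : IsLocalFlow O H x₀ r ε Z) {t : ℝ} (ht : t ∈ Set.Ioo (-ε) ε) (y : Pos n)
    {ξ : Pos n} (hξ : ξ ≠ 0) : HasFDerivAt Z (fderiv ℝ Z (t, y, ξ)) (t, y, ξ) :=
  ((h.contDiffAt ht y hξ).differentiableAt (by simp)).hasFDerivAt

theorem energy_eq (h : IsLocalFlow O H x₀ r ε Z)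
    (hH : IsHomogeneousHamiltonian O H) {t : ℝ} (ht : t ∈ Set.Ioo (-ε) ε) {y : Pos n}
    (hy : y ∈ Metric.ball x₀ (2 * r)) {ξ : Pos n} (hξ : ξ ≠ 0) :
    H (Z (t, y, ξ)) = H (y, covec n ξ) := by
  have hd : ∀ s ∈ Set.Ioo (-ε) ε, HasDerivAt (fun s => H (Z (s, y, ξ))) 0 s := fun s hs =>
    Eikonal.hasDerivAt_energy (γ := fun s => Z (s, y, ξ))
      (hH.differentiableAt (h.mem s hs y hy ξ hξ)) (h.hasDerivAt s hs y hy ξ hξ)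
  have := isOpen_Ioo.is_const_of_deriv_eq_zero isPreconnected_Ioo
    (fun s hs => (hd s hs).differentiableAt.differentiableWithinAt)
    (fun s hs => (hd s hs).deriv) ht h.zero_mem
  rw [this, h.initial y ξ hξ]

/-- The flow preserves the Liouville form: `Ξ · dX = ξ · dy` at every fixed time. -/
theorem liouville (h : IsLocalFlow O H x₀ r ε Z)
    (hH : IsHomogeneousHamiltonian O H) {t : ℝ} (ht : t ∈ Set.Ioo (-ε) ε) {y : Pos n}
    (hy : y ∈ Metric.ball x₀ (2 * r)) {ξ : Pos n} (hξ : ξ ≠ 0) (δ : Pos n × Pos n) :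
    (Z (t, y, ξ)).2 (fderiv ℝ Z (t, y, ξ) (0, δ)).1 = inner ℝ ξ δ.1 := by
  have hd : ∀ s ∈ Set.Ioo (-ε) ε,
      HasDerivAt (fun s => (Z (s, y, ξ)).2 (fderiv ℝ Z (s, y, ξ) (0, δ)).1) 0 s := by
    intro s hs
    have hnhds : Set.Ioo (-ε) ε ×ˢ Metric.ball x₀ (2 * r) ×ˢ {0}ᶜ ∈ 𝓝 (s, y, ξ) :=
      (isOpen_Ioo.prod (Metric.isOpen_ball.prod isOpen_compl_singleton)).mem_nhds ⟨hs, hy, hξ⟩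
    refine hasDerivAt_liouville hH.isOpen_prod (hH.contDiffOn.differentiableOn (by simp))
      hH.homogeneous (h.contDiffAt hs y hξ)
      ?_ ?_ δ
    · filter_upwards [hnhds] with x hx using h.mem _ hx.1 _ hx.2.1 _ hx.2.2
    · filter_upwards [hnhds] with x hx using h.hasDerivAt _ hx.1 _ hx.2.1 _ hx.2.2
  have hconst := isOpen_Ioo.is_const_of_deriv_eq_zero isPreconnected_Ioo
    (fun s hs => (hd s hs).differentiableAt.differentiableWithinAt)
    (fun s hs => (hd s hs).deriv) ht h.zero_mem
  rw [hconst, h.initial y ξ hξ]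
  have h1 : HasFDerivAt (fun q => Z (0, q)) (fderiv ℝ Z (0, y, ξ) ∘L .inr ℝ ℝ (Pos n × Pos n))
      (y, ξ) :=
    HasFDerivAt.comp (y, ξ) (h.hasFDerivAt h.zero_mem y hξ) (hasFDerivAt_prodMk_right 0 (y, ξ))
  have h2 : HasFDerivAt (fun q => Z (0, q))
      ((ContinuousLinearMap.fst ℝ (Pos n) (Pos n)).prod
        ((covec n : Pos n →L[ℝ] Pos n →L[ℝ] ℝ) ∘L ContinuousLinearMap.snd ℝ (Pos n) (Pos n)))
      (y, ξ) := by
    refine (hasFDerivAt_fst.prodMk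
      ((covec n).hasFDerivAt.comp (y, ξ) hasFDerivAt_snd)).congr_of_eventuallyEq ?_
    filter_upwards [(isOpen_univ.prod isOpen_compl_singleton).mem_nhds
      (show (y, ξ) ∈ Set.univ ×ˢ {0}ᶜ from ⟨trivial, hξ⟩)] with q hq
    exact h.initial q.1 q.2 hq.2
  have h3 := congrArg (fun L => (L δ).1) (h1.unique h2)
  simp only [ContinuousLinearMap.comp_apply, ContinuousLinearMap.inr_apply,
    ContinuousLinearMap.prod_apply, ContinuousLinearMap.coe_fst'] at h3
  rw [h3, covec_apply]

end IsLocalFlow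

/-- `Y (t, ·, ξ)` is the inverse of the map that takes `y` to the base point, at the time `-t`, of
the flow `Z` of `(y, ⟪ξ, ·⟫)`. -/
structure IsBackwardInverse {n : ℕ} (ε : ℝ) (Z : ℝ × Pos n × Pos n → PhaseSpace n)
    (Y : ℝ × Pos n × Pos n → Pos n) : Prop where
  contDiffOn : ContDiffOn ℝ ∞ Y (Set.Ioo (-ε) ε ×ˢ Set.univ ×ˢ {0}ᶜ)
  iff : ∀ t ∈ Set.Ioo (-ε) ε, ∀ x y ξ, ξ ≠ 0 → (Y (t, x, ξ) = y ↔ (Z (-t, y, ξ)).1 = x)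

namespace IsLocalFlow

variable {n : ℕ} {O : Set (Pos n)} {H : PhaseSpace n → ℝ} {x₀ : Pos n} {r ε : ℝ}
  {Z : ℝ × Pos n × Pos n → PhaseSpace n} {Y : ℝ × Pos n × Pos n → Pos n}

/-- The point `y = Y (t, x, ξ)` is the fixed point of the contraction `y ↦ x - (X(-t, y, ξ) - y)`,
where `X` is the base component of the flow. -/
theorem exists_isBackwardInverse (h : IsLocalFlow O H x₀ r ε Z) :
    ∃ Y, IsBackwardInverse ε Z Y := by
  set U : Set (ℝ × Pos n × Pos n) := Set.Ioo (-ε) ε ×ˢ Set.univ ×ˢ {0}ᶜ with hU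
  set T : (ℝ × Pos n × Pos n) × Pos n → Pos n :=
    fun q => q.1.2.1 - ((Z (-q.1.1, q.2, q.1.2.2)).1 - q.2) with hT
  have hlip : ∀ q ∈ U, LipschitzWith 2⁻¹ fun y => T (q, y) := by
    intro q hq
    refine LipschitzWith.of_dist_le_mul fun y y' => ?_
    simp only [hT, dist_sub_left]
    exact (h.lipschitz _ (neg_mem_Ioo hq.1) q.2.2).dist_le_mul y y'
  have hcon : ∀ q ∈ U, ContractingWith 2⁻¹ fun y => T (q, y) := fun q hq =>
    ⟨by rw [← NNReal.coe_lt_coe]; norm_num, hlip q hq⟩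
  have hTs : ∀ q ∈ U, ∀ y, ContDiffAt ℝ ∞ T (q, y) := by
    intro q hq y
    have h1 : ContDiffAt ℝ ∞ (fun q : (ℝ × Pos n × Pos n) × Pos n => (-q.1.1, q.2, q.1.2.2))
        (q, y) := by fun_prop
    have h2 : ContDiffAt ℝ ∞
        (fun q : (ℝ × Pos n × Pos n) × Pos n => Z (-q.1.1, q.2, q.1.2.2)) (q, y) :=
      ContDiffAt.comp (q, y) (h.contDiffAt (neg_mem_Ioo hq.1) y hq.2.2) h1
    have h3 : ContDiffAt ℝ ∞ (fun q : (ℝ × Pos n × Pos n) × Pos n => q.1.2.1) (q, y) := by fun_prop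
    exact h3.sub (h2.fst.sub contDiffAt_snd)
  have hex : ∀ q, ∃ y, q ∈ U → T (q, y) = y := by
    intro q
    by_cases hq : q ∈ U
    · exact ⟨_, fun _ => (hcon q hq).fixedPoint_isFixedPt⟩
    · exact ⟨0, fun h => absurd h hq⟩
  choose Y hY using hex
  refine ⟨Y, fun q hq => ?_, fun t ht x y ξ hξ => ?_⟩
  · exact (contDiffAt_fixedPoint ((isOpen_dom n ε).mem_nhds hq) (hTs q hq _) hlip
      hY).contDiffWithinAt
  · have hq : (t, x, ξ) ∈ U := ⟨ht, trivial, hξ⟩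
    have hiff : ∀ y, T ((t, x, ξ), y) = y ↔ (Z (-t, y, ξ)).1 = x := by
      intro y
      simp only [hT]
      rw [sub_eq_iff_eq_add, add_sub_cancel, eq_comm]
    rw [← hiff]
    refine ⟨fun e => e ▸ hY _ hq, fun e => (hcon _ hq).fixedPoint_unique' (hY _ hq) e⟩

theorem base_apply (hY : IsBackwardInverse ε Z Y) {t : ℝ} (ht : t ∈ Set.Ioo (-ε) ε) (x : Pos n)
    {ξ : Pos n} (hξ : ξ ≠ 0) : (Z (-t, Y (t, x, ξ), ξ)).1 = x :=
  (hY.iff t ht x _ ξ hξ).1 rfl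

theorem backward_zero (h : IsLocalFlow O H x₀ r ε Z) (hY : IsBackwardInverse ε Z Y) (x : Pos n)
    {ξ : Pos n} (hξ : ξ ≠ 0) : Y (0, x, ξ) = x := by
  rw [hY.iff 0 h.zero_mem x x ξ hξ, neg_zero, h.initial x ξ hξ]

theorem backward_smul (h : IsLocalFlow O H x₀ r ε Z) (hY : IsBackwardInverse ε Z Y) {t : ℝ}
    (ht : t ∈ Set.Ioo (-ε) ε) (x : Pos n) {ξ : Pos n} (hξ : ξ ≠ 0) {l : ℝ} (hl : 0 < l) :
    Y (t, x, l • ξ) = Y (t, x, ξ) := by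
  rw [hY.iff t ht x _ _ (smul_ne_zero hl.ne' hξ), h.ray _ _ _ l hl, base_apply hY ht x hξ]

theorem backward_mem_ball (h : IsLocalFlow O H x₀ r ε Z) (hY : IsBackwardInverse ε Z Y) {t : ℝ}
    (ht : t ∈ Set.Ioo (-ε) ε) {x : Pos n} (hx : x ∈ Metric.ball x₀ r) {ξ : Pos n} (hξ : ξ ≠ 0) :
    Y (t, x, ξ) ∈ Metric.ball x₀ (2 * r) := by
  have h1 := h.near (-t) (neg_mem_Ioo ht) (Y (t, x, ξ)) ξ
  rw [base_apply hY ht x hξ, ← dist_eq_norm, dist_comm] at h1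
  rw [Metric.mem_ball] at hx ⊢
  linarith [dist_triangle (Y (t, x, ξ)) x x₀]

theorem backward_contDiffAt (hY : IsBackwardInverse ε Z Y) {t : ℝ} (ht : t ∈ Set.Ioo (-ε) ε)
    (x : Pos n) {ξ : Pos n} (hξ : ξ ≠ 0) : ContDiffAt ℝ ∞ Y (t, x, ξ) :=
  hY.contDiffOn.contDiffAt ((isOpen_dom n ε).mem_nhds ⟨ht, trivial, hξ⟩)

theorem backward_hasFDerivAt (hY : IsBackwardInverse ε Z Y) {t : ℝ} (ht : t ∈ Set.Ioo (-ε) ε)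
    (x : Pos n) {ξ : Pos n} (hξ : ξ ≠ 0) :
    HasFDerivAt Y (fderiv ℝ Y (t, x, ξ)) (t, x, ξ) :=
  ((backward_contDiffAt hY ht x hξ).differentiableAt (by simp)).hasFDerivAt

/-- The derivative of the identity `(Z (-t, Y (t, x, ξ), ξ)).1 = x`. -/
theorem fderiv_base_apply (h : IsLocalFlow O H x₀ r ε Z) (hY : IsBackwardInverse ε Z Y) {t : ℝ}
    (ht : t ∈ Set.Ioo (-ε) ε) (x : Pos n) {ξ : Pos n} (hξ : ξ ≠ 0) (δ : ℝ × Pos n × Pos n) :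
    (fderiv ℝ Z (-t, Y (t, x, ξ), ξ) (-δ.1, fderiv ℝ Y (t, x, ξ) δ, δ.2.2)).1 = δ.2.1 := by
  have h1 : HasFDerivAt (fun q : ℝ × Pos n × Pos n => (-q.1, Y q, q.2.2))
      ((-ContinuousLinearMap.fst ℝ ℝ (Pos n × Pos n)).prod ((fderiv ℝ Y (t, x, ξ)).prod
        (ContinuousLinearMap.snd ℝ (Pos n) (Pos n) ∘L
          ContinuousLinearMap.snd ℝ ℝ (Pos n × Pos n)))) (t, x, ξ) :=
    (hasFDerivAt_fst.neg).prodMk ((backward_hasFDerivAt hY ht x hξ).prodMk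
      (hasFDerivAt_snd.comp (t, x, ξ) hasFDerivAt_snd))
  have h2 := (HasFDerivAt.comp (t, x, ξ) (g := Z)
    (h.hasFDerivAt (neg_mem_Ioo ht) (Y (t, x, ξ)) hξ) h1).fst
  have h3 : HasFDerivAt (fun q : ℝ × Pos n × Pos n => (Z (-q.1, Y q, q.2.2)).1)
      (ContinuousLinearMap.fst ℝ (Pos n) (Pos n) ∘L
          ContinuousLinearMap.snd ℝ ℝ (Pos n × Pos n)) (t, x, ξ) := by
    refine (hasFDerivAt_fst.comp (t, x, ξ) hasFDerivAt_snd).congr_of_eventuallyEq ?_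
    filter_upwards [(isOpen_dom n ε).mem_nhds
      (show (t, x, ξ) ∈ Set.Ioo (-ε) ε ×ˢ Set.univ ×ˢ {0}ᶜ from ⟨ht, trivial, hξ⟩)] with q hq
    exact base_apply hY hq.1 q.2.1 hq.2.2
  have h4 := congrArg (fun L => L δ) (HasFDerivAt.unique h2 h3)
  simpa using h4

/-- The total differential of the phase `w(t, x, ξ) = Y(t, x, ξ) · ξ`: `∂_t w = H(Y, ξ)` is the
energy, `∂_x w` is the covector that the flow has over `x` at the time `-t`, and `∂_ξ w = Y`. The
derivative `v` of `Y` is eliminated by the invariance of the Liouville form, `ξ · v = Ξ · (∂X (v,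
δξ))`, in which the derivative of `X(-t, Y, ξ) = x` gives the value of `∂X (v, δξ)`. -/
theorem fderiv_phase (h : IsLocalFlow O H x₀ r ε Z) (hY : IsBackwardInverse ε Z Y)
    (hH : IsHomogeneousHamiltonian O H) {t : ℝ} (ht : t ∈ Set.Ioo (-ε) ε) {x : Pos n}
    (hx : x ∈ Metric.ball x₀ r) {ξ : Pos n} (hξ : ξ ≠ 0) (δ : ℝ × Pos n × Pos n) :
    fderiv ℝ (fun q : ℝ × Pos n × Pos n => inner ℝ (Y q) q.2.2) (t, x, ξ) δ =
      δ.1 * H (Y (t, x, ξ), covec n ξ) + (Z (-t, Y (t, x, ξ), ξ)).2 δ.2.1 +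
        inner ℝ (Y (t, x, ξ)) δ.2.2 := by
  have hYd := backward_hasFDerivAt hY ht x hξ
  have ht' := neg_mem_Ioo ht
  have hy := backward_mem_ball h hY ht hx hξ
  set y := Y (t, x, ξ) with hydef
  set v := fderiv ℝ Y (t, x, ξ) δ with hvdef
  have e1 : fderiv ℝ (fun q : ℝ × Pos n × Pos n => inner ℝ (Y q) q.2.2) (t, x, ξ) δ =
      inner ℝ y δ.2.2 + inner ℝ v ξ := by
    have h2 : HasFDerivAt (fun q : ℝ × Pos n × Pos n => q.2.2)
      (ContinuousLinearMap.snd ℝ (Pos n) (Pos n) ∘L ContinuousLinearMap.snd ℝ ℝ (Pos n × Pos n))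
      (t, x, ξ) := hasFDerivAt_snd.comp (t, x, ξ) hasFDerivAt_snd
    rw [fderiv_inner_apply ℝ hYd.differentiableAt h2.differentiableAt, h2.fderiv]
    rfl
  have e2 := h.fderiv_base_apply hY ht x hξ δ
  have e3 := h.liouville hH ht' hy hξ (v, δ.2.2)
  have hsplit : ((-δ.1, v, δ.2.2) : ℝ × Pos n × Pos n) = (-δ.1) • (1, 0) + (0, (v, δ.2.2)) := by
    simp
  have hvel : fderiv ℝ Z (-t, y, ξ) (1, 0) = hamVec H (Z (-t, y, ξ)) := by
    have h1 : HasDerivAt (fun s : ℝ => ((s, y, ξ) : ℝ × Pos n × Pos n)) (1, 0) (-t) :=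
      (hasDerivAt_id _).prodMk (hasDerivAt_const _ _)
    exact (HasFDerivAt.comp_hasDerivAt (-t) (l := Z) (h.hasFDerivAt ht' y hξ) h1).unique
      (h.hasDerivAt _ ht' y hy ξ hξ)
  have hmem := h.mem _ ht' y hy ξ hξ
  have e4 : (Z (-t, y, ξ)).2 (hamVec H (Z (-t, y, ξ))).1 = H (y, covec n ξ) := by
    rw [apply_hamVec_fst (hH.differentiableAt hmem) (hH.homogeneous _ hmem),
      h.energy_eq hH ht' hy hξ]
  rw [hsplit, map_add, map_smul, hvel, Prod.fst_add, Prod.smul_fst] at e2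
  rw [e1, ← e2, map_add, map_smul, e4, e3, real_inner_comm v ξ]
  simp only [smul_eq_mul]
  ring

theorem hasFDerivAt_phase (hY : IsBackwardInverse ε Z Y) {t : ℝ} (ht : t ∈ Set.Ioo (-ε) ε)
    (x : Pos n) {ξ : Pos n} (hξ : ξ ≠ 0) :
    HasFDerivAt (fun q : ℝ × Pos n × Pos n => inner ℝ (Y q) q.2.2)
      (fderiv ℝ (fun q : ℝ × Pos n × Pos n => inner ℝ (Y q) q.2.2) (t, x, ξ)) (t, x, ξ) :=
  (DifferentiableAt.inner ℝ (backward_hasFDerivAt hY ht x hξ).differentiableAt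
    (differentiableAt_snd.comp _ differentiableAt_snd)).hasFDerivAt

/-- `∂_x w` is the covector over `x` of the backward flow. -/
theorem hasFDerivAt_phase_base (h : IsLocalFlow O H x₀ r ε Z) (hY : IsBackwardInverse ε Z Y)
    (hH : IsHomogeneousHamiltonian O H) {t : ℝ} (ht : t ∈ Set.Ioo (-ε) ε) {x : Pos n}
    (hx : x ∈ Metric.ball x₀ r) {ξ : Pos n} (hξ : ξ ≠ 0) :
    HasFDerivAt (fun x' => inner ℝ (Y (t, x', ξ)) ξ) (Z (-t, Y (t, x, ξ), ξ)).2 x := by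
  have h1 : HasFDerivAt (fun x' => ((t, x', ξ) : ℝ × Pos n × Pos n))
      (.inr ℝ ℝ (Pos n × Pos n) ∘L .inl ℝ (Pos n) (Pos n)) x :=
    HasFDerivAt.comp x (hasFDerivAt_prodMk_right t (x, ξ)) (hasFDerivAt_prodMk_left x ξ)
  have h2 := HasFDerivAt.comp x (hasFDerivAt_phase hY ht x hξ) h1
  refine h2.congr_fderiv ?_
  ext a
  have := h.fderiv_phase hY hH ht hx hξ (0, a, 0)
  simpa using this

/-- `∂_t w` is the energy. -/
theorem hasDerivAt_phase_time (h : IsLocalFlow O H x₀ r ε Z) (hY : IsBackwardInverse ε Z Y)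
    (hH : IsHomogeneousHamiltonian O H) {t : ℝ} (ht : t ∈ Set.Ioo (-ε) ε) {x : Pos n}
    (hx : x ∈ Metric.ball x₀ r) {ξ : Pos n} (hξ : ξ ≠ 0) :
    HasDerivAt (fun s => inner ℝ (Y (s, x, ξ)) ξ) (H (Y (t, x, ξ), covec n ξ)) t := by
  have h1 : HasDerivAt (fun s : ℝ => ((s, x, ξ) : ℝ × Pos n × Pos n)) (1, 0) t :=
    (hasDerivAt_id t).prodMk (hasDerivAt_const _ _)
  have h2 := HasFDerivAt.comp_hasDerivAt t (hasFDerivAt_phase hY ht x hξ) h1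
  refine h2.congr_deriv ?_
  rw [h.fderiv_phase hY hH ht hx hξ (1, 0)]
  simp

/-- `∂_ξ w` is the starting point of the backward flow. -/
theorem hasGradientAt_phase (h : IsLocalFlow O H x₀ r ε Z) (hY : IsBackwardInverse ε Z Y)
    (hH : IsHomogeneousHamiltonian O H) {t : ℝ} (ht : t ∈ Set.Ioo (-ε) ε) {x : Pos n}
    (hx : x ∈ Metric.ball x₀ r) {ξ : Pos n} (hξ : ξ ≠ 0) :
    HasGradientAt (fun ξ' => inner ℝ (Y (t, x, ξ')) ξ') (Y (t, x, ξ)) ξ := by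
  have h1 : HasFDerivAt (fun ξ' => ((t, x, ξ') : ℝ × Pos n × Pos n))
      (.inr ℝ ℝ (Pos n × Pos n) ∘L .inr ℝ (Pos n) (Pos n)) ξ :=
    HasFDerivAt.comp ξ (hasFDerivAt_prodMk_right t (x, ξ)) (hasFDerivAt_prodMk_right x ξ)
  have h2 := HasFDerivAt.comp ξ (hasFDerivAt_phase hY ht x hξ) h1
  rw [hasGradientAt_iff_hasFDerivAt]
  refine h2.congr_fderiv ?_
  ext a
  have := h.fderiv_phase hY hH ht hx hξ (0, 0, a)
  simpa using this

/-- The eikonal equation `H(x, ∂_x w) = ∂_t w`, by conservation of energy. -/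
theorem hamiltonian_phase_base (h : IsLocalFlow O H x₀ r ε Z) (hY : IsBackwardInverse ε Z Y)
    (hH : IsHomogeneousHamiltonian O H) {t : ℝ} (ht : t ∈ Set.Ioo (-ε) ε) {x : Pos n}
    (hx : x ∈ Metric.ball x₀ r) {ξ : Pos n} (hξ : ξ ≠ 0) :
    H (x, (Z (-t, Y (t, x, ξ), ξ)).2) = H (Y (t, x, ξ), covec n ξ) := by
  rw [← h.energy_eq hH (neg_mem_Ioo ht) (backward_mem_ball h hY ht hx hξ) hξ]
  congr 1
  exact Prod.ext (base_apply hY ht x hξ).symm rfl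

/-- The partial derivative `∂_y X` of the base component of the flow is injective, since it differs
from the identity by an operator of norm at most `1/2`. -/
theorem injective_fderiv_base (h : IsLocalFlow O H x₀ r ε Z) {t : ℝ} (ht : t ∈ Set.Ioo (-ε) ε)
    (y : Pos n) {ξ : Pos n} (hξ : ξ ≠ 0) {v : Pos n}
    (hv : (fderiv ℝ Z (t, y, ξ) (0, v, 0)).1 = 0) : v = 0 := by
  have h1 : HasFDerivAt (fun y' => ((t, y', ξ) : ℝ × Pos n × Pos n))
      (.inr ℝ ℝ (Pos n × Pos n) ∘L .inl ℝ (Pos n) (Pos n)) y :=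
    HasFDerivAt.comp y (hasFDerivAt_prodMk_right t (y, ξ)) (hasFDerivAt_prodMk_left y ξ)
  have h2 := ((HasFDerivAt.comp y (g := Z) (h.hasFDerivAt ht y hξ) h1).fst.sub
    (hasFDerivAt_id y)).le_of_lipschitz (h.lipschitz t ht ξ)
  have h3 := ContinuousLinearMap.le_of_opNorm_le _ h2 v
  simp only [FunLike.coe_sub, Pi.sub_apply, ContinuousLinearMap.comp_apply,
    ContinuousLinearMap.inl_apply, ContinuousLinearMap.inr_apply, ContinuousLinearMap.coe_fst', hv,
    ContinuousLinearMap.id_apply, zero_sub, norm_neg, NNReal.coe_inv, NNReal.coe_ofNat] at h3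
  rw [← norm_eq_zero]
  linarith [norm_nonneg v]

/-- `∂_ξ Y` and `∂_ξ X` have the same rank, by `∂_ξ X = -∂_y X ∘ ∂_ξ Y`. -/
theorem finrank_range_backward (h : IsLocalFlow O H x₀ r ε Z) (hY : IsBackwardInverse ε Z Y)
    {t : ℝ} (ht : t ∈ Set.Ioo (-ε) ε) (x : Pos n) {ξ : Pos n} (hξ : ξ ≠ 0) :
    Module.finrank ℝ (fderiv ℝ (fun ξ' => Y (t, x, ξ')) ξ).range =
      Module.finrank ℝ (fderiv ℝ (fun ξ' => (Z (-t, Y (t, x, ξ), ξ')).1) ξ).range := by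
  have ht' := neg_mem_Ioo ht
  set y := Y (t, x, ξ) with hydef
  have hin : ∀ (s : ℝ) (a : Pos n), HasFDerivAt (fun ξ' => ((s, a, ξ') : ℝ × Pos n × Pos n))
      (.inr ℝ ℝ (Pos n × Pos n) ∘L .inr ℝ (Pos n) (Pos n)) ξ := fun s a =>
    HasFDerivAt.comp ξ (hasFDerivAt_prodMk_right s (a, ξ)) (hasFDerivAt_prodMk_right a ξ)
  have h1 := HasFDerivAt.comp ξ (g := Y) (backward_hasFDerivAt hY ht x hξ) (hin t x)
  have h2 := (HasFDerivAt.comp ξ (g := Z) (h.hasFDerivAt ht' y hξ) (hin (-t) y)).fst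
  have e1 := h1.fderiv
  have e2 := h2.fderiv
  simp only [Function.comp_def] at e1 e2
  rw [e1, e2]
  set B := fderiv ℝ Y (t, x, ξ) ∘L (.inr ℝ ℝ (Pos n × Pos n) ∘L .inr ℝ (Pos n) (Pos n)) with hB
  set D := fderiv ℝ Z (-t, y, ξ) with hD
  set C := ContinuousLinearMap.fst ℝ (Pos n) (Pos n →L[ℝ] ℝ) ∘L D ∘L
    (.inr ℝ ℝ (Pos n × Pos n) ∘L .inr ℝ (Pos n) (Pos n)) with hC
  set A := ContinuousLinearMap.fst ℝ (Pos n) (Pos n →L[ℝ] ℝ) ∘L D ∘L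
    (.inr ℝ ℝ (Pos n × Pos n) ∘L .inl ℝ (Pos n) (Pos n)) with hA
  have hAinj : Function.Injective (A : Pos n →ₗ[ℝ] Pos n) := by
    rw [← LinearMap.ker_eq_bot, LinearMap.ker_eq_bot']
    intro v hv
    exact h.injective_fderiv_base ht' y hξ hv
  -- the `ξ`-derivative of `X(-t, Y(t, x, ξ), ξ) = x`
  have hCA : (C : Pos n →ₗ[ℝ] Pos n) = -((A : Pos n →ₗ[ℝ] Pos n) ∘ₗ (B : Pos n →ₗ[ℝ] Pos n)) := by
    ext1 δ
    have := h.fderiv_base_apply hY ht x hξ (0, 0, δ)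
    have hs : ((-0, fderiv ℝ Y (t, x, ξ) (0, 0, δ), δ) : ℝ × Pos n × Pos n) =
      (0, B δ, 0) + (0, 0, δ) := by simp [hB]
    simp only at this
    rw [hs, map_add, Prod.fst_add] at this
    exact (neg_eq_of_add_eq_zero_right this).symm
  change Module.finrank ℝ (B : Pos n →ₗ[ℝ] Pos n).range =
    Module.finrank ℝ (C : Pos n →ₗ[ℝ] Pos n).range
  rw [hCA, LinearMap.range_neg, LinearMap.range_comp]
  exact (Submodule.equivMapOfInjective _ hAinj _).finrank_eq

end IsLocalFlow

/-! ### Charts and canonical coordinates -/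

section Charts

theorem mem_transition_source {X E : Type*} [TopologicalSpace X] [TopologicalSpace E]
    {e e' : OpenPartialHomeomorph X E} {y : X} (hy : y ∈ e.source) (hy' : y ∈ e'.source) :
    e y ∈ (e.symm.trans e').source := by
  simp [hy, hy']

variable {n : ℕ} {M : Type*} [TopologicalSpace M] [ChartedSpace (EuclideanSpace ℝ (Fin n)) M]
  {e e' : OpenPartialHomeomorph M (EuclideanSpace ℝ (Fin n))}

theorem mdifferentiable_of_mem_maximalAtlas (he : e ∈ IsManifold.maximalAtlas (𝓡 n) ∞ M) :
    e.MDifferentiable (𝓡 n) (𝓡 n) :=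
  ⟨(contMDiffOn_of_mem_maximalAtlas he).mdifferentiableOn (by simp),
    (contMDiffOn_symm_of_mem_maximalAtlas he).mdifferentiableOn (by simp)⟩

/-- The derivative of a chart at a point of the manifold, with values in the model space. -/
def chartDeriv (e : OpenPartialHomeomorph M (EuclideanSpace ℝ (Fin n))) (x : M) :
    TangentSpace (𝓡 n) x →L[ℝ] Pos n :=
  mfderiv (𝓡 n) (𝓡 n) e x

/-- The inverse of the derivative of a chart at a point of the manifold. -/
def chartDerivInv (e : OpenPartialHomeomorph M (EuclideanSpace ℝ (Fin n))) (x : M) :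
    Pos n →L[ℝ] TangentSpace (𝓡 n) x :=
  (mfderiv (𝓡 n) (𝓡 n) e x).inverse

theorem isInvertible_chartDeriv [IsManifold (𝓡 n) ∞ M]
    (he : e ∈ IsManifold.maximalAtlas (𝓡 n) ∞ M) {x : M}
    (hx : x ∈ e.source) : (chartDeriv e x).IsInvertible :=
  ⟨(mdifferentiable_of_mem_maximalAtlas he).mfderiv hx, rfl⟩

theorem chartDeriv_comp_inv [IsManifold (𝓡 n) ∞ M]
    (he : e ∈ IsManifold.maximalAtlas (𝓡 n) ∞ M) {x : M}
    (hx : x ∈ e.source) : (chartDeriv e x).comp (chartDerivInv e x) = .id ℝ (Pos n) :=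
  (isInvertible_chartDeriv he hx).self_comp_inverse

theorem chartDerivInv_comp [IsManifold (𝓡 n) ∞ M]
    (he : e ∈ IsManifold.maximalAtlas (𝓡 n) ∞ M) {x : M}
    (hx : x ∈ e.source) : (chartDerivInv e x).comp (chartDeriv e x) = .id ℝ _ :=
  (isInvertible_chartDeriv he hx).inverse_comp_self

theorem contDiffOn_transition (he : e ∈ IsManifold.maximalAtlas (𝓡 n) ∞ M)
    (he' : e' ∈ IsManifold.maximalAtlas (𝓡 n) ∞ M) :
    ContDiffOn ℝ ∞ (e' ∘ e.symm) (e.symm.trans e').source := by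
  rw [← contMDiffOn_iff_contDiffOn]
  refine (contMDiffOn_of_mem_maximalAtlas (I := 𝓡 n) he').comp
    ((contMDiffOn_symm_of_mem_maximalAtlas (I := 𝓡 n) he).mono ?_) ?_
  · intro x hx
    rw [OpenPartialHomeomorph.trans_source] at hx
    exact hx.1
  · intro x hx
    rw [OpenPartialHomeomorph.trans_source] at hx
    exact hx.2

theorem contDiffAt_transition [IsManifold (𝓡 n) ∞ M] (he : e ∈ IsManifold.maximalAtlas (𝓡 n) ∞ M)
    (he' : e' ∈ IsManifold.maximalAtlas (𝓡 n) ∞ M) {y : M} (hy : y ∈ e.source)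
    (hy' : y ∈ e'.source) : ContDiffAt ℝ ∞ (e' ∘ e.symm) (e y) :=
  (contDiffOn_transition he he').contDiffAt
    ((e.symm.trans e').open_source.mem_nhds (mem_transition_source hy hy'))

theorem chartDeriv_eq_fderiv_transition_comp [IsManifold (𝓡 n) ∞ M]
    (he : e ∈ IsManifold.maximalAtlas (𝓡 n) ∞ M)
    (he' : e' ∈ IsManifold.maximalAtlas (𝓡 n) ∞ M) {y : M} (hy : y ∈ e.source)
    (hy' : y ∈ e'.source) :
    chartDeriv e' y = (fderiv ℝ (e' ∘ e.symm) (e y)).comp (chartDeriv e y) := by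
  have h1 : HasMFDerivAt (𝓡 n) (𝓡 n) (e' ∘ e.symm) (e y) (fderiv ℝ (e' ∘ e.symm) (e y)) :=
    ((contDiffAt_transition he he' hy hy').differentiableAt (by simp)).hasFDerivAt.hasMFDerivAt
  have h2 : HasMFDerivAt (𝓡 n) (𝓡 n) e y (mfderiv (𝓡 n) (𝓡 n) e y) :=
    ((mdifferentiable_of_mem_maximalAtlas he).mdifferentiableAt hy).hasMFDerivAt
  refine ((h1.comp y h2).congr_of_eventuallyEq ?_).mfderiv
  filter_upwards [e.open_source.mem_nhds hy] with z hz
  simp [hz]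

theorem chartDeriv_comp_chartDerivInv [IsManifold (𝓡 n) ∞ M]
    (he : e ∈ IsManifold.maximalAtlas (𝓡 n) ∞ M)
    (he' : e' ∈ IsManifold.maximalAtlas (𝓡 n) ∞ M) {y : M} (hy : y ∈ e.source)
    (hy' : y ∈ e'.source) :
    (chartDeriv e y).comp (chartDerivInv e' y) = fderiv ℝ (e ∘ e'.symm) (e' y) := by
  rw [chartDeriv_eq_fderiv_transition_comp he' he hy' hy, ContinuousLinearMap.comp_assoc,
    chartDeriv_comp_inv he' hy', ContinuousLinearMap.comp_id]

theorem canonicalCoord_def (e : OpenPartialHomeomorph M (EuclideanSpace ℝ (Fin n)))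
    (p : CotBundle n M) :
    canonicalCoord e p = (e p.proj, p.2.comp (chartDerivInv e p.proj)) := rfl

theorem ofCanonical_def (e : OpenPartialHomeomorph M (EuclideanSpace ℝ (Fin n)))
    (z : PhaseSpace n) :
    ofCanonical e z = ⟨e.symm z.1, z.2.comp (chartDeriv e (e.symm z.1))⟩ := rfl

theorem ofCanonical_apply [IsManifold (𝓡 n) ∞ M] {y : M} (hy : y ∈ e.source) (η : Pos n →L[ℝ] ℝ) :
    ofCanonical e (e y, η) = ⟨y, η.comp (chartDeriv e y)⟩ := by
  rw [ofCanonical_def]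
  simp only
  rw [e.left_inv hy]

theorem canonicalCoord_mk [IsManifold (𝓡 n) ∞ M]
    (he : e ∈ IsManifold.maximalAtlas (𝓡 n) ∞ M) {y : M}
    (hy : y ∈ e.source) (η : Pos n →L[ℝ] ℝ) :
    canonicalCoord e (⟨y, η.comp (chartDeriv e y)⟩ : CotBundle n M) = (e y, η) := by
  rw [canonicalCoord_def]
  simp only
  rw [ContinuousLinearMap.comp_assoc, chartDeriv_comp_inv he hy, ContinuousLinearMap.comp_id]

theorem canonicalCoord_ofCanonical [IsManifold (𝓡 n) ∞ M]
    (he : e ∈ IsManifold.maximalAtlas (𝓡 n) ∞ M)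
    {z : PhaseSpace n} (hz : z.1 ∈ e.target) : canonicalCoord e (ofCanonical e z) = z := by
  rw [ofCanonical_def, canonicalCoord_mk he (e.map_target hz), e.right_inv hz]

theorem ofCanonical_canonicalCoord [IsManifold (𝓡 n) ∞ M]
    (he : e ∈ IsManifold.maximalAtlas (𝓡 n) ∞ M)
    {p : CotBundle n M} (hp : p.proj ∈ e.source) : ofCanonical e (canonicalCoord e p) = p := by
  obtain ⟨y, α⟩ := p
  rw [canonicalCoord_def, ofCanonical_apply hp, ContinuousLinearMap.comp_assoc,
    chartDerivInv_comp he hp, ContinuousLinearMap.comp_id]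

theorem ofCanonical_mem_slit [IsManifold (𝓡 n) ∞ M]
    (he : e ∈ IsManifold.maximalAtlas (𝓡 n) ∞ M) {z : PhaseSpace n}
    (hz : z.1 ∈ e.target) (hz' : z.2 ≠ 0) : ofCanonical e z ∈ slitCotBundle n M := by
  intro h0
  apply hz'
  have := congrArg Prod.snd (canonicalCoord_ofCanonical he hz)
  rw [← this, canonicalCoord_def]
  simp only
  rw [h0, ContinuousLinearMap.zero_comp]

theorem canonicalCoord_snd_ne_zero [IsManifold (𝓡 n) ∞ M]
    (he : e ∈ IsManifold.maximalAtlas (𝓡 n) ∞ M)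
    {p : CotBundle n M} (hp : p.proj ∈ e.source) (h : p ∈ slitCotBundle n M) :
    (canonicalCoord e p).2 ≠ 0 := by
  intro h0
  apply h
  rw [← ofCanonical_canonicalCoord he hp, ofCanonical_def]
  simp only
  rw [h0, ContinuousLinearMap.zero_comp]

/-- The change from the canonical coordinates of the chart `e` to those of `e'`. -/
def canonicalTransition (e e' : OpenPartialHomeomorph M (EuclideanSpace ℝ (Fin n)))
    (z : PhaseSpace n) : PhaseSpace n :=
  ((e' ∘ e.symm) z.1, z.2.comp (fderiv ℝ (e ∘ e'.symm) ((e' ∘ e.symm) z.1)))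

theorem canonicalCoord_eq_transition [IsManifold (𝓡 n) ∞ M]
    (he : e ∈ IsManifold.maximalAtlas (𝓡 n) ∞ M)
    (he' : e' ∈ IsManifold.maximalAtlas (𝓡 n) ∞ M) {p : CotBundle n M}
    (hp : p.proj ∈ e.source) (hp' : p.proj ∈ e'.source) :
    canonicalCoord e' p = canonicalTransition e e' (canonicalCoord e p) := by
  simp only [canonicalTransition, canonicalCoord_def, Function.comp_apply, e.left_inv hp]
  rw [← chartDeriv_comp_chartDerivInv he he' hp hp', ContinuousLinearMap.comp_assoc,
    ← ContinuousLinearMap.comp_assoc (chartDerivInv e p.proj), chartDerivInv_comp he hp,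
    ContinuousLinearMap.id_comp]

theorem ofCanonical_transition [IsManifold (𝓡 n) ∞ M] (he : e ∈ IsManifold.maximalAtlas (𝓡 n) ∞ M)
    (he' : e' ∈ IsManifold.maximalAtlas (𝓡 n) ∞ M) {z : PhaseSpace n}
    (hz : z.1 ∈ (e.symm.trans e').source) :
    ofCanonical e' (canonicalTransition e e' z) = ofCanonical e z := by
  rw [OpenPartialHomeomorph.trans_source] at hz
  have h1 : (ofCanonical e z).proj ∈ e.source := e.map_target hz.1
  have h2 : (ofCanonical e z).proj ∈ e'.source := hz.2
  rw [← canonicalCoord_ofCanonical he hz.1 (z := z), ← canonicalCoord_eq_transition he he' h1 h2,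
    ofCanonical_canonicalCoord he' h2, canonicalCoord_ofCanonical he hz.1]

/-- The trivializations of the tangent bundle are the derivatives of the charts. -/
theorem symmL_trivializationAt_eq [IsManifold (𝓡 n) ∞ M] {x₀ x : M}
    (hx : x ∈ (chartAt (EuclideanSpace ℝ (Fin n)) x₀).source) :
    (trivializationAt (EuclideanSpace ℝ (Fin n)) (TangentSpace (𝓡 n)) x₀).symmL ℝ x =
      chartDerivInv (chartAt (EuclideanSpace ℝ (Fin n)) x₀) x := by
  have : IsManifold (𝓡 n) 1 M := IsManifold.of_le (n := ∞) (by simp)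
  have hφ := IsManifold.chart_mem_maximalAtlas (I := 𝓡 n) (n := ∞) x₀
  have h1 : (trivializationAt (EuclideanSpace ℝ (Fin n)) (TangentSpace (𝓡 n))
      x₀).continuousLinearMapAt ℝ x = chartDeriv (chartAt (EuclideanSpace ℝ (Fin n)) x₀) x :=
    TangentBundle.continuousLinearMapAt_trivializationAt hx
  ext1 v
  have h2 := (trivializationAt (EuclideanSpace ℝ (Fin n)) (TangentSpace (𝓡 n))
    x₀).continuousLinearMapAt_symmL (R := ℝ) (b := x) (by simpa using hx) v
  rw [h1] at h2
  have h3 := congrArg (fun L => L ((trivializationAt (EuclideanSpace ℝ (Fin n))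
    (TangentSpace (𝓡 n)) x₀).symmL ℝ x v)) (chartDerivInv_comp hφ hx)
  simp only [ContinuousLinearMap.comp_apply, ContinuousLinearMap.id_apply] at h3
  rw [← h3, h2]

/-- Canonical coordinates are smooth coordinates of the cotangent bundle. The bundle has its smooth
structure from the trivializations over the preferred charts `φ`, in which `ofCanonical e` is the
composition with the Jacobian of the transition `e ∘ φ⁻¹`. -/
theorem contMDiffOn_ofCanonical [IsManifold (𝓡 n) ∞ M]
    (he : e ∈ IsManifold.maximalAtlas (𝓡 n) ∞ M) :
    ContMDiffOn 𝓘(ℝ, PhaseSpace n) (cotModel n) ∞ (ofCanonical e : PhaseSpace n → CotBundle n M)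
      (e.target ×ˢ Set.univ) := by
  intro z₀ hz₀
  apply ContMDiffAt.contMDiffWithinAt
  have htar : e.target ×ˢ Set.univ ∈ 𝓝 z₀ := (e.open_target.prod isOpen_univ).mem_nhds hz₀
  have hbase : ContMDiffAt 𝓘(ℝ, PhaseSpace n) (𝓡 n) ∞ (fun z : PhaseSpace n => e.symm z.1) z₀ :=
    ((contMDiffOn_symm_of_mem_maximalAtlas he).contMDiffAt
      (e.open_target.mem_nhds hz₀.1)).comp z₀ contDiff_fst.contDiffAt.contMDiffAt
  rw [contMDiffAt_hom_bundle]
  refine ⟨hbase, ?_⟩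
  set x₀ := e.symm z₀.1 with hx₀
  set φ := chartAt (EuclideanSpace ℝ (Fin n)) x₀ with hφ
  have hφm : φ ∈ IsManifold.maximalAtlas (𝓡 n) ∞ M := IsManifold.chart_mem_maximalAtlas x₀
  have hx₀φ : x₀ ∈ φ.source := mem_chart_source _ x₀
  have hx₀e : x₀ ∈ e.source := e.map_target hz₀.1
  have hsm : ContDiffAt ℝ ∞
      (fun z : PhaseSpace n => z.2.comp (fderiv ℝ (e ∘ φ.symm) ((φ ∘ e.symm) z.1))) z₀ := by
    have h1 : ContDiffAt ℝ ∞ (fun z : PhaseSpace n => (φ ∘ e.symm) z.1) z₀ := by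
      have := contDiffAt_transition he hφm hx₀e hx₀φ
      rw [hx₀, e.right_inv hz₀.1] at this
      exact this.comp z₀ contDiffAt_fst
    have h2 : ContDiffAt ℝ ∞ (fderiv ℝ (e ∘ φ.symm)) ((φ ∘ e.symm) z₀.1) :=
      (contDiffAt_transition hφm he hx₀φ hx₀e).fderiv_right (by simp)
    exact contDiffAt_snd.clm_comp (h2.comp z₀ h1)
  refine hsm.contMDiffAt.congr_of_eventuallyEq ?_
  filter_upwards [htar, hbase.continuousAt.preimage_mem_nhds (φ.open_source.mem_nhds hx₀φ)]
    with z hz hzφ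
  have hzφ' : e.symm z.1 ∈ φ.source := hzφ
  have hze : e.symm z.1 ∈ e.source := e.map_target hz.1
  simp only [Function.comp_apply]
  rw [← chartDeriv_comp_chartDerivInv he hφm hze hzφ', ContinuousLinearMap.inCoordinates,
    ← symmL_trivializationAt_eq hzφ', ← ContinuousLinearMap.comp_assoc]
  have htriv : (trivializationAt ℝ (Bundle.Trivial M ℝ)
      (ofCanonical e z₀).proj).continuousLinearMapAt ℝ (ofCanonical e z).proj = .id ℝ ℝ :=
    Bundle.Trivial.continuousLinearMapAt_trivialization ℝ M ℝ _
  ext v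
  exact congrArg (fun L => L (z.2 (chartDeriv e (e.symm z.1) ((trivializationAt
    (EuclideanSpace ℝ (Fin n)) (TangentSpace (𝓡 n)) x₀).symmL ℝ (e.symm z.1) v)))) htriv

end Charts

/-! ### Hamiltonian curves on the manifold and in a chart -/

section Transition

variable {n : ℕ}

/-- A change of coordinates `τ` of the base, with the inverse `σ`, induces the symplectic change
`(x, η) ↦ (τ(x), η ∘ Dσ)` of canonical coordinates. The terms with second derivatives cancel in
the symplectic form by their symmetry. -/
theorem hasFDerivAt_cotangentLift {τ σ : Pos n → Pos n} {z : PhaseSpace n}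
    (hτ : ContDiffAt ℝ ∞ τ z.1) (hσ : ContDiffAt ℝ ∞ σ (τ z.1))
    (hστ : ∀ᶠ x in 𝓝 z.1, σ (τ x) = x) :
    ∃ D : PhaseSpace n →L[ℝ] PhaseSpace n,
      HasFDerivAt (fun z : PhaseSpace n => (τ z.1, z.2.comp (fderiv ℝ σ (τ z.1)))) D z ∧
      ∀ u v, canonicalSymplectic (D u) (D v) = canonicalSymplectic u v := by
  obtain ⟨x, η⟩ := z
  simp only at hτ hσ hστ
  set g : Pos n → Pos n →L[ℝ] Pos n := fun x => fderiv ℝ σ (τ x) with hg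
  have hgs : ContDiffAt ℝ ∞ g x :=
    ContDiffAt.comp x (hσ.fderiv_right (m := ∞) (by simp)) hτ
  have hgd : HasFDerivAt g (fderiv ℝ g x) x := (hgs.differentiableAt (by simp)).hasFDerivAt
  have hτd : HasFDerivAt τ (fderiv ℝ τ x) x := (hτ.differentiableAt (by simp)).hasFDerivAt
  have hτd2 : HasFDerivAt (fderiv ℝ τ) (fderiv ℝ (fderiv ℝ τ) x) x :=
    ((hτ.fderiv_right (m := ∞) (by simp)).differentiableAt (by simp)).hasFDerivAt
  have hsymm : ∀ a b, fderiv ℝ (fderiv ℝ τ) x a b = fderiv ℝ (fderiv ℝ τ) x b a := fun a b =>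
    (hτ.isSymmSndFDerivAt (by
      rw [minSmoothness_of_isRCLikeNormedField]
      exact WithTop.coe_le_coe.2 (le_top : (2 : ℕ∞) ≤ ⊤))).eq a b
  have hinv : ∀ᶠ x' in 𝓝 x, (g x').comp (fderiv ℝ τ x') = .id ℝ (Pos n) := by
    have e1 := (hτ.of_le (m := 1) (by simp)).eventually (by simp)
    have e2 := hτ.continuousAt.eventually ((hσ.of_le (m := 1) (by simp)).eventually (by simp))
    filter_upwards [e1, e2, hστ.eventually_nhds] with x' h1 h2 h3
    have h4 := HasFDerivAt.comp x' (h2.differentiableAt (by simp)).hasFDerivAt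
      (h1.differentiableAt (by simp)).hasFDerivAt
    exact h4.unique ((hasFDerivAt_id x').congr_of_eventuallyEq h3)
  have hinvx : ∀ a, fderiv ℝ σ (τ x) (fderiv ℝ τ x a) = a := fun a =>
    congrArg (fun L => L a) hinv.self_of_nhds
  -- differentiating the relation between the two Jacobians
  have hrel : ∀ a b, fderiv ℝ g x b (fderiv ℝ τ x a) = -g x (fderiv ℝ (fderiv ℝ τ) x b a) := by
    intro a b
    have h1 := (hgd.clm_comp hτd2).unique
      ((hasFDerivAt_const (ContinuousLinearMap.id ℝ (Pos n)) x).congr_of_eventuallyEq hinv)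
    have h2 := congrArg (fun L => L b a) h1
    simp at h2
    exact eq_neg_of_add_eq_zero_right h2
  have hfst : HasFDerivAt (fun z : PhaseSpace n => z.1) (.fst ℝ _ _) (x, η) := hasFDerivAt_fst
  have hsnd : HasFDerivAt (fun z : PhaseSpace n => z.2) (.snd ℝ _ _) (x, η) := hasFDerivAt_snd
  have hτ1 : HasFDerivAt (fun z : PhaseSpace n => τ z.1) _ (x, η) :=
    HasFDerivAt.comp (x, η) (g := τ) hτd hfst
  have hg1 : HasFDerivAt (fun z : PhaseSpace n => g z.1) _ (x, η) :=
    HasFDerivAt.comp (x, η) (g := g) hgd hfst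
  refine ⟨_, hτ1.prodMk (hsnd.clm_comp hg1), ?_⟩
  rintro ⟨a, α⟩ ⟨b, β⟩
  simp [canonicalSymplectic, hrel, hinvx, hsymm a b]

end Transition

section Charts

variable {n : ℕ} {M : Type*} [TopologicalSpace M] [ChartedSpace (EuclideanSpace ℝ (Fin n)) M]
  {e e' : OpenPartialHomeomorph M (EuclideanSpace ℝ (Fin n))} {A : CotBundle n M → ℝ}

theorem contDiffOn_comp_ofCanonical [IsManifold (𝓡 n) ∞ M]
    (he : e ∈ IsManifold.maximalAtlas (𝓡 n) ∞ M)
    (hA : ContMDiffOn (cotModel n) 𝓘(ℝ, ℝ) ∞ A (slitCotBundle n M)) :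
    ContDiffOn ℝ ∞ (fun z => A (ofCanonical e z)) (e.target ×ˢ {0}ᶜ) := by
  rw [← contMDiffOn_iff_contDiffOn]
  exact hA.comp ((contMDiffOn_ofCanonical he).mono
    (Set.prod_mono_right (Set.subset_univ _))) fun z hz => ofCanonical_mem_slit he hz.1 hz.2

/-- Hamilton's equations are independent of the chart. -/
theorem isHamiltonianVector_transition [IsManifold (𝓡 n) ∞ M]
    (he : e ∈ IsManifold.maximalAtlas (𝓡 n) ∞ M)
    (he' : e' ∈ IsManifold.maximalAtlas (𝓡 n) ∞ M)
    (hA : ContMDiffOn (cotModel n) 𝓘(ℝ, ℝ) ∞ A (slitCotBundle n M))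
    {γ : ℝ → CotBundle n M} {s : ℝ} (hcont : ContinuousAt (fun r => (γ r).proj) s)
    (hs : (γ s).proj ∈ e.source) (hs' : (γ s).proj ∈ e'.source) (hslit : γ s ∈ slitCotBundle n M)
    {X : PhaseSpace n} (hX : HasDerivAt (fun r => canonicalCoord e (γ r)) X s)
    (hH : IsHamiltonianVector (fun z => A (ofCanonical e z)) (canonicalCoord e (γ s)) X) :
    ∃ X', HasDerivAt (fun r => canonicalCoord e' (γ r)) X' s ∧
      IsHamiltonianVector (fun z => A (ofCanonical e' z)) (canonicalCoord e' (γ s)) X' := by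
  set z := canonicalCoord e (γ s) with hz
  have hz1 : z.1 = e (γ s).proj := rfl
  have hτ : ContDiffAt ℝ ∞ (e' ∘ e.symm) z.1 := contDiffAt_transition he he' hs hs'
  have hτz : (e' ∘ e.symm) z.1 = e' (γ s).proj := by
    rw [hz1, Function.comp_apply, e.left_inv hs]
  have hσ : ContDiffAt ℝ ∞ (e ∘ e'.symm) ((e' ∘ e.symm) z.1) := by
    rw [hτz]
    exact contDiffAt_transition he' he hs' hs
  have hsrc : (e.symm.trans e').source ∈ 𝓝 z.1 :=
    (e.symm.trans e').open_source.mem_nhds (mem_transition_source hs hs')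
  have hστ : ∀ᶠ x in 𝓝 z.1, (e ∘ e'.symm) ((e' ∘ e.symm) x) = x := by
    filter_upwards [hsrc] with x hx
    rw [OpenPartialHomeomorph.trans_source] at hx
    simp only [Function.comp_apply]
    rw [e'.left_inv hx.2, e.right_inv hx.1]
  obtain ⟨D, hD, hDω⟩ := hasFDerivAt_cotangentLift hτ hσ hστ
  change HasFDerivAt (canonicalTransition e e') D z at hD
  have hTz : canonicalTransition e e' z = canonicalCoord e' (γ s) :=
    (canonicalCoord_eq_transition he he' hs hs').symm
  refine ⟨D X, ?_, ?_⟩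
  · refine (HasFDerivAt.comp_hasDerivAt s (l := canonicalTransition e e')
      (f := fun r => canonicalCoord e (γ r)) hD hX).congr_of_eventuallyEq ?_
    filter_upwards [hcont.preimage_mem_nhds (e.open_source.mem_nhds hs),
      hcont.preimage_mem_nhds (e'.open_source.mem_nhds hs')] with r hr hr'
    exact canonicalCoord_eq_transition he he' hr hr'
  · have hinj : Function.Injective (D : PhaseSpace n →ₗ[ℝ] PhaseSpace n) := by
      intro u u' h
      refine eq_of_canonicalSymplectic fun v => ?_
      rw [← hDω, ← hDω u' v]
      exact congrArg (fun w => canonicalSymplectic w (D v)) h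
    have hF' : DifferentiableAt ℝ (fun z => A (ofCanonical e' z)) (canonicalCoord e' (γ s)) :=
      ((contDiffOn_comp_ofCanonical he' hA).contDiffAt
        ((e'.open_target.prod isOpen_compl_singleton).mem_nhds
          ⟨e'.map_source hs', canonicalCoord_snd_ne_zero he' hs' hslit⟩)).differentiableAt (by simp)
    have hF : HasFDerivAt (fun z => A (ofCanonical e z))
        ((fderiv ℝ (fun z => A (ofCanonical e' z)) (canonicalCoord e' (γ s))).comp D) z := by
      rw [← hTz] at hF' ⊢
      refine (HasFDerivAt.comp z hF'.hasFDerivAt hD).congr_of_eventuallyEq ?_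
      filter_upwards [(continuousAt_fst (p := z)).preimage_mem_nhds hsrc] with w hw
      exact congrArg A (ofCanonical_transition he he' hw).symm
    intro v
    obtain ⟨u, rfl⟩ := (LinearMap.injective_iff_surjective.1 hinj) v
    have h1 := hH u
    rw [hF.fderiv] at h1
    exact h1.trans (hDω X u).symm

/-- A solution of Hamilton's equations in one chart is an integral curve on the manifold. -/
theorem isHamiltonianCurveOn_ofCanonical [IsManifold (𝓡 n) ∞ M]
    (he : e ∈ IsManifold.maximalAtlas (𝓡 n) ∞ M)
    (hA : ContMDiffOn (cotModel n) 𝓘(ℝ, ℝ) ∞ A (slitCotBundle n M))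
    {z : ℝ → PhaseSpace n} {J : Set ℝ} (hJ : IsOpen J)
    (hz : ∀ s ∈ J, z s ∈ e.target ×ˢ ({0}ᶜ : Set (Pos n →L[ℝ] ℝ)))
    (hd : ∀ s ∈ J, HasDerivAt z (hamVec (fun z => A (ofCanonical e z)) (z s)) s) :
    IsHamiltonianCurveOn (slitCotBundle n M) A (fun s => ofCanonical e (z s)) J := by
  have hcont : ∀ s ∈ J, ContinuousAt (fun s => (ofCanonical e (z s)).proj) s := fun s hs =>
    (e.symm.continuousAt (hz s hs).1).comp (f := fun s => (z s).1)
      (continuousAt_fst.comp (hd s hs).continuousAt)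
  refine ⟨fun s hs => (hcont s hs).continuousWithinAt, fun s hs => ?_⟩
  have hmem := ofCanonical_mem_slit he (hz s hs).1 (hz s hs).2
  refine ⟨hmem, fun e' he' hs' => ?_⟩
  have hcc := canonicalCoord_ofCanonical he (hz s hs).1
  refine isHamiltonianVector_transition he he' hA (hcont s hs) (e.map_target (hz s hs).1) hs' hmem
    (X := hamVec (fun z => A (ofCanonical e z)) (z s)) ?_ ?_
  · refine (hd s hs).congr_of_eventuallyEq ?_
    filter_upwards [hJ.mem_nhds hs] with r hr using canonicalCoord_ofCanonical he (hz r hr).1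
  · rw [hcc, isHamiltonianVector_iff]

/-- An integral curve on the manifold that meets a solution of Hamilton's equations in a chart
agrees with it at all times. -/
theorem IsHamiltonianCurveOn.eq_ofCanonical [IsManifold (𝓡 n) ∞ M] [T2Space M]
    (he : e ∈ IsManifold.maximalAtlas (𝓡 n) ∞ M)
    (hA : ContMDiffOn (cotModel n) 𝓘(ℝ, ℝ) ∞ A (slitCotBundle n M))
    {z : ℝ → PhaseSpace n} {γ : ℝ → CotBundle n M} {a b : ℝ}
    (hγ : IsHamiltonianCurveOn (slitCotBundle n M) A γ (Set.Ioo a b))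
    (hz : ∀ s ∈ Set.Ioo a b, z s ∈ e.target ×ˢ ({0}ᶜ : Set (Pos n →L[ℝ] ℝ)))
    (hd : ∀ s ∈ Set.Ioo a b, HasDerivAt z (hamVec (fun z => A (ofCanonical e z)) (z s)) s)
    {t₀ : ℝ} (ht₀ : t₀ ∈ Set.Ioo a b) (h0 : γ t₀ = ofCanonical e (z t₀)) {t : ℝ}
    (ht : t ∈ Set.Ioo a b) : γ t = ofCanonical e (z t) := by
  set F : PhaseSpace n → ℝ := fun z => A (ofCanonical e z) with hF
  set Ω : Set (PhaseSpace n) := e.target ×ˢ {0}ᶜ with hΩ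
  have hΩo : IsOpen Ω := e.open_target.prod isOpen_compl_singleton
  have hFs : ContDiffOn ℝ ∞ F Ω := contDiffOn_comp_ofCanonical he hA
  set S : Set ℝ := {s | s ∈ Set.Ioo a b ∧ γ s = ofCanonical e (z s)} with hS
  have hproj : ∀ s ∈ Set.Ioo a b, ContinuousAt (fun r => (γ r).proj) s := fun s hs =>
    hγ.1.continuousAt (isOpen_Ioo.mem_nhds hs)
  -- the velocity of `γ`, read in the chart
  have hvel : ∀ s ∈ Set.Ioo a b, (γ s).proj ∈ e.source →
      HasDerivAt (fun r => canonicalCoord e (γ r)) (hamVec F (canonicalCoord e (γ s))) s := by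
    intro s hs hse
    obtain ⟨X, hX, hXH⟩ := (hγ.2 s hs).2 e he hse
    rw [isHamiltonianVector_iff] at hXH
    rwa [hXH] at hX
  -- local uniqueness for the ordinary differential equation in the chart
  have hSopen : IsOpen S := by
    rw [isOpen_iff_mem_nhds]
    rintro s ⟨hs, hs'⟩
    have hse : (γ s).proj ∈ e.source := by rw [hs']; exact e.map_target (hz s hs).1
    have hcc : canonicalCoord e (γ s) = z s := by
      rw [hs', canonicalCoord_ofCanonical he (hz s hs).1]
    obtain ⟨K, T, hT, hLip⟩ := (((contDiffOn_hamVec hΩo hFs).contDiffAt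
      (hΩo.mem_nhds (hz s hs))).of_le (m := 1) (by simp)).exists_lipschitzOnWith
    have hev : ∀ᶠ r in 𝓝 s, r ∈ Set.Ioo a b ∧ (γ r).proj ∈ e.source :=
      (isOpen_Ioo.eventually_mem hs).and
        ((hproj s hs).preimage_mem_nhds (e.open_source.mem_nhds hse))
    have huniq : (fun r => canonicalCoord e (γ r)) =ᶠ[𝓝 s] z := by
      refine ODE_solution_unique_of_eventually (v := fun _ => hamVec F) (s := fun _ => T) (K := K)
        (Filter.Eventually.of_forall fun _ => hLip) ?_ ?_ hcc
      · have hcT := (hvel s hs hse).continuousAt.preimage_mem_nhds (by rw [hcc]; exact hT)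
        filter_upwards [hev, hcT] with r hr hrT
        exact ⟨hvel r hr.1 hr.2, hrT⟩
      · filter_upwards [hev, (hd s hs).continuousAt.preimage_mem_nhds hT] with r hr hrT
        exact ⟨hd r hr.1, hrT⟩
    filter_upwards [hev, huniq] with r hr hr'
    refine ⟨hr.1, ?_⟩
    rw [← hr', ofCanonical_canonicalCoord he hr.2]
  -- a limit point stays over the chart since limits in `M` are unique
  have hSclosed : closure S ∩ Set.Ioo a b ⊆ S := by
    rintro s ⟨hsc, hs⟩
    refine ⟨hs, ?_⟩
    have : (𝓝[S] s).NeBot := mem_closure_iff_nhdsWithin_neBot.1 hsc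
    have hc : ContinuousAt (fun r => e.symm (z r).1) s :=
      (e.symm.continuousAt (hz s hs).1).comp (f := fun s => (z s).1)
        (continuousAt_fst.comp (hd s hs).continuousAt)
    have h1 : (γ s).proj = e.symm (z s).1 := by
      refine tendsto_nhds_unique (l := 𝓝[S] s) ((hproj s hs).mono_left nhdsWithin_le_nhds)
        ((hc.mono_left nhdsWithin_le_nhds).congr' ?_)
      filter_upwards [self_mem_nhdsWithin] with r hr
      rw [hr.2]
      rfl
    have hse : (γ s).proj ∈ e.source := by rw [h1]; exact e.map_target (hz s hs).1
    have h2 : canonicalCoord e (γ s) = z s := by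
      refine tendsto_nhds_unique (l := 𝓝[S] s)
        ((hvel s hs hse).continuousAt.mono_left nhdsWithin_le_nhds)
        (((hd s hs).continuousAt.mono_left nhdsWithin_le_nhds).congr' ?_)
      filter_upwards [self_mem_nhdsWithin] with r hr
      rw [hr.2, canonicalCoord_ofCanonical he (hz r hr.1).1]
    rw [← h2, ofCanonical_canonicalCoord he hse]
  exact (isPreconnected_Ioo.subset_of_closure_inter_subset hSopen ⟨t₀, ht₀, ht₀, h0⟩ hSclosed ht).2

/-- The flow on the manifold is the flow in the chart. In particular the choice in the definition of
`hamFlow` is of a unique point. -/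
theorem flowsTo_iff_of_chart [IsManifold (𝓡 n) ∞ M] [T2Space M]
    (he : e ∈ IsManifold.maximalAtlas (𝓡 n) ∞ M)
    (hA : ContMDiffOn (cotModel n) 𝓘(ℝ, ℝ) ∞ A (slitCotBundle n M))
    {z : ℝ → PhaseSpace n} {a b : ℝ} (h0 : (0 : ℝ) ∈ Set.Ioo a b)
    (hz : ∀ s ∈ Set.Ioo a b, z s ∈ e.target ×ˢ ({0}ᶜ : Set (Pos n →L[ℝ] ℝ)))
    (hd : ∀ s ∈ Set.Ioo a b, HasDerivAt z (hamVec (fun z => A (ofCanonical e z)) (z s)) s) {t : ℝ}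
    (ht : t ∈ Set.Ioo a b) {q : CotBundle n M} :
    FlowsTo (slitCotBundle n M) A t (ofCanonical e (z 0)) q ↔ q = ofCanonical e (z t) := by
  constructor
  · rintro ⟨γ, a', b', h0', ht', hγ, hγ0, rfl⟩
    have hsub : Set.Ioo (max a a') (min b b') = Set.Ioo a b ∩ Set.Ioo a' b' :=
      Set.Ioo_inter_Ioo.symm
    have hγ' : IsHamiltonianCurveOn (slitCotBundle n M) A γ (Set.Ioo (max a a') (min b b')) := by
      rw [hsub]
      exact ⟨hγ.1.mono Set.inter_subset_right, fun s hs => hγ.2 s hs.2⟩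
    exact hγ'.eq_ofCanonical he hA (fun s hs => hz s (hsub ▸ hs).1)
      (fun s hs => hd s (hsub ▸ hs).1) (t₀ := 0) (by rw [hsub]; exact ⟨h0, h0'⟩) hγ0
      (by rw [hsub]; exact ⟨ht, ht'⟩)
  · rintro rfl
    exact ⟨_, a, b, h0, ht, isHamiltonianCurveOn_ofCanonical he hA isOpen_Ioo hz hd, rfl, rfl⟩

theorem hamFlow_eq_of_chart [IsManifold (𝓡 n) ∞ M] [T2Space M]
    (he : e ∈ IsManifold.maximalAtlas (𝓡 n) ∞ M)
    (hA : ContMDiffOn (cotModel n) 𝓘(ℝ, ℝ) ∞ A (slitCotBundle n M))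
    {z : ℝ → PhaseSpace n} {a b : ℝ} (h0 : (0 : ℝ) ∈ Set.Ioo a b)
    (hz : ∀ s ∈ Set.Ioo a b, z s ∈ e.target ×ˢ ({0}ᶜ : Set (Pos n →L[ℝ] ℝ)))
    (hd : ∀ s ∈ Set.Ioo a b, HasDerivAt z (hamVec (fun z => A (ofCanonical e z)) (z s)) s) {t : ℝ}
    (ht : t ∈ Set.Ioo a b) :
    ofCanonical e (z 0) ∈ flowDomain (slitCotBundle n M) A t ∧
      hamFlow (slitCotBundle n M) A t (ofCanonical e (z 0)) = ofCanonical e (z t) := by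
  have hiff := fun q => flowsTo_iff_of_chart he hA h0 hz hd ht (q := q)
  have hex : ∃ q, FlowsTo (slitCotBundle n M) A t (ofCanonical e (z 0)) q := ⟨_, (hiff _).2 rfl⟩
  refine ⟨hex, ?_⟩
  rw [hamFlow, dif_pos hex]
  exact (hiff _).1 hex.choose_spec

end Charts

/-! ### Coefficients of covectors -/

section Coefficients

variable {n : ℕ} {M : Type*} [TopologicalSpace M] [ChartedSpace (EuclideanSpace ℝ (Fin n)) M]
  {e : OpenPartialHomeomorph M (EuclideanSpace ℝ (Fin n))} {A : CotBundle n M → ℝ}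

theorem coordForm_eq (e : OpenPartialHomeomorph M (EuclideanSpace ℝ (Fin n))) (ξ : Pos n) (y : M) :
    coordForm e ξ y = (covec n ξ).comp (chartDeriv e y) := rfl

/-- The linear map that takes a covector `ξ · dx|_y` to its coefficients `ξ`, on the normed space
that underlies `T*_y M`. -/
def coordCoeff (e : OpenPartialHomeomorph M (EuclideanSpace ℝ (Fin n))) (y : M) :
    (Pos n →L[ℝ] ℝ) →L[ℝ] Pos n :=
  LinearMap.toContinuousLinearMap
    { toFun := fun η : Pos n →L[ℝ] ℝ =>
        (covec n).symm (η.comp (chartDerivInv e y : Pos n →L[ℝ] Pos n))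
      map_add' := fun η η' => (congrArg (covec n).symm
        (ContinuousLinearMap.add_comp η η' (chartDerivInv e y))).trans (map_add _ _ _)
      map_smul' := fun c η => (congrArg (covec n).symm
        (ContinuousLinearMap.smul_comp c η (chartDerivInv e y))).trans (map_smul _ _ _) }

theorem coordCoeff_coordForm [IsManifold (𝓡 n) ∞ M]
    (he : e ∈ IsManifold.maximalAtlas (𝓡 n) ∞ M) {y : M}
    (hy : y ∈ e.source) (ξ : Pos n) : coordCoeff e y (coordForm e ξ y) = ξ := by
  change (covec n).symm (((covec n ξ).comp (chartDeriv e y)).comp (chartDerivInv e y)) = ξ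
  rw [ContinuousLinearMap.comp_assoc, chartDeriv_comp_inv he hy, ContinuousLinearMap.comp_id,
    ContinuousLinearEquiv.symm_apply_apply]

theorem coordForm_coordCoeff [IsManifold (𝓡 n) ∞ M]
    (he : e ∈ IsManifold.maximalAtlas (𝓡 n) ∞ M) {y : M}
    (hy : y ∈ e.source) (η : CotSpace n y) : coordForm e (coordCoeff e y η) y = η := by
  change (covec n ((covec n).symm (η.comp (chartDerivInv e y)))).comp (chartDeriv e y) = η
  rw [ContinuousLinearEquiv.apply_symm_apply, ContinuousLinearMap.comp_assoc,
    chartDerivInv_comp he hy, ContinuousLinearMap.comp_id]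

theorem comp_chartDeriv_ne_zero [IsManifold (𝓡 n) ∞ M]
    (he : e ∈ IsManifold.maximalAtlas (𝓡 n) ∞ M) {y : M}
    (hy : y ∈ e.source) {η : Pos n →L[ℝ] ℝ} (hη : η ≠ 0) : η.comp (chartDeriv e y) ≠ 0 := by
  intro h0
  apply hη
  rw [← ContinuousLinearMap.comp_id η, ← chartDeriv_comp_inv he hy,
    ← ContinuousLinearMap.comp_assoc, h0, ContinuousLinearMap.zero_comp]

theorem homogeneous_comp_ofCanonical [IsManifold (𝓡 n) ∞ M]
    (he : e ∈ IsManifold.maximalAtlas (𝓡 n) ∞ M)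
    (hom : ∀ (x : M) (α : CotSpace n x), α ≠ 0 → ∀ l : ℝ, 0 < l →
      A ⟨x, l • α⟩ = l * A ⟨x, α⟩) :
    ∀ z ∈ e.target ×ˢ ({0}ᶜ : Set (Pos n →L[ℝ] ℝ)), ∀ l : ℝ, 0 < l →
      A (ofCanonical e (z.1, l • z.2)) = l * A (ofCanonical e z) := by
  rintro ⟨x, η⟩ ⟨hx, hη⟩ l hl
  rw [ofCanonical_def, ofCanonical_def]
  simp only
  rw [ContinuousLinearMap.smul_comp,
    hom _ _ (comp_chartDeriv_ne_zero he (e.map_target hx) hη) l hl]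

theorem mfderiv_ne_zero_of_comp {E₁ H₁ N₁ E₂ H₂ N₂ : Type*} [NormedAddCommGroup E₁]
    [NormedSpace ℝ E₁] [TopologicalSpace H₁] {I₁ : ModelWithCorners ℝ E₁ H₁}
    [TopologicalSpace N₁] [ChartedSpace H₁ N₁] [NormedAddCommGroup E₂]
    [NormedSpace ℝ E₂] [TopologicalSpace H₂] {I₂ : ModelWithCorners ℝ E₂ H₂}
    [TopologicalSpace N₂] [ChartedSpace H₂ N₂] {g : N₁ → N₂} {f : N₂ → ℝ} {x : N₁}
    (hf : MDifferentiableAt I₂ 𝓘(ℝ, ℝ) f (g x)) (hg : MDifferentiableAt I₁ I₂ g x)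
    (h : mfderiv I₁ 𝓘(ℝ, ℝ) (f ∘ g) x ≠ 0) : mfderiv I₂ 𝓘(ℝ, ℝ) f (g x) ≠ 0 := by
  intro h0
  apply h
  rw [mfderiv_comp x hf hg, h0]
  exact ContinuousLinearMap.zero_comp _

end Coefficients

/-! ### The phase -/

section CoordinatePhase

variable {n : ℕ} {M : Type*} [TopologicalSpace M]
  {e : OpenPartialHomeomorph M (EuclideanSpace ℝ (Fin n))}
  {O : Set (Pos n)} {H : PhaseSpace n → ℝ} {o : M} {r ε : ℝ}
  {Z : ℝ × Pos n × Pos n → PhaseSpace n} {Y : ℝ × Pos n × Pos n → Pos n}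

/-- The coordinate ball of radius `r` around `o`: the points of the domain of `e` that have their
coordinates in the ball. -/
def coordBall (e : OpenPartialHomeomorph M (EuclideanSpace ℝ (Fin n))) (o : M) (r : ℝ) : Set M :=
  e.source ∩ e ⁻¹' Metric.ball (e o) r

theorem isOpen_coordBall (e : OpenPartialHomeomorph M (EuclideanSpace ℝ (Fin n))) (o : M)
    (r : ℝ) : IsOpen (coordBall e o r) :=
  e.isOpen_inter_preimage Metric.isOpen_ball

theorem mem_ball_two_of_mem_coordBall (hr : 0 < r) {y : M} (hy : y ∈ coordBall e o r) :
    e y ∈ Metric.ball (e o) (2 * r) :=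
  Metric.ball_subset_ball (by linarith) hy.2

/-- The phase `w(t, x, ξ) = Y(t, x, ξ) · ξ`, where `Y(t, x, ξ)` stands for the starting point of the
Hamiltonian curve with initial covector `ξ` that is over `x` at the time `-t`. -/
def eikonalPhase (e : OpenPartialHomeomorph M (EuclideanSpace ℝ (Fin n)))
    (Y : ℝ × Pos n × Pos n → Pos n) (t : ℝ) (x : M) (ξ : Pos n) : ℝ :=
  inner ℝ (Y (t, e x, ξ)) ξ

theorem eikonalPhase_smul (h : IsLocalFlow O H (e o) r ε Z) (hY : IsBackwardInverse ε Z Y)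
    {t : ℝ} (ht : t ∈ Set.Ioo (-ε) ε) (x : M) {ξ : Pos n} (hξ : ξ ≠ 0) {l : ℝ} (hl : 0 < l) :
    eikonalPhase e Y t x (l • ξ) = l * eikonalPhase e Y t x ξ := by
  rw [eikonalPhase, eikonalPhase, h.backward_smul hY ht _ hξ hl, real_inner_smul_right]

theorem eikonalPhase_zero (h : IsLocalFlow O H (e o) r ε Z) (hY : IsBackwardInverse ε Z Y)
    (x : M) {ξ : Pos n} (hξ : ξ ≠ 0) : eikonalPhase e Y 0 x ξ = inner ℝ (e x) ξ := by
  rw [eikonalPhase, h.backward_zero hY _ hξ]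

theorem gradient_eikonalPhase (h : IsLocalFlow O H (e o) r ε Z) (hY : IsBackwardInverse ε Z Y)
    (hH : IsHomogeneousHamiltonian O H) {t : ℝ} (ht : t ∈ Set.Ioo (-ε) ε) {x : M}
    (hx : x ∈ coordBall e o r) {ξ : Pos n} (hξ : ξ ≠ 0) :
    gradient (eikonalPhase e Y t x) ξ = Y (t, e x, ξ) :=
  (h.hasGradientAt_phase hY hH ht hx.2 hξ).gradient

theorem fderiv_gradient_eikonalPhase (h : IsLocalFlow O H (e o) r ε Z)
    (hY : IsBackwardInverse ε Z Y) (hH : IsHomogeneousHamiltonian O H) {t : ℝ}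
    (ht : t ∈ Set.Ioo (-ε) ε) {x : M} (hx : x ∈ coordBall e o r) {ξ : Pos n} (hξ : ξ ≠ 0) :
    fderiv ℝ (gradient (eikonalPhase e Y t x)) ξ = fderiv ℝ (fun ξ' => Y (t, e x, ξ')) ξ :=
  Filter.EventuallyEq.fderiv_eq <| (eventually_ne_nhds hξ).mono fun _ hξ' =>
    gradient_eikonalPhase h hY hH ht hx hξ'

theorem contDiffAt_inner_backward (hY : IsBackwardInverse ε Z Y) {t : ℝ}
    (ht : t ∈ Set.Ioo (-ε) ε) (x : Pos n) {ξ : Pos n} (hξ : ξ ≠ 0) :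
    ContDiffAt ℝ ∞ (fun q : ℝ × Pos n × Pos n => inner ℝ (Y q) q.2.2) (t, x, ξ) :=
  (IsLocalFlow.backward_contDiffAt hY ht x hξ).inner ℝ (contDiffAt_snd.comp _ contDiffAt_snd)

end CoordinatePhase

section Phase

variable {n : ℕ} {M : Type*} [TopologicalSpace M] [ChartedSpace (EuclideanSpace ℝ (Fin n)) M]
  {e : OpenPartialHomeomorph M (EuclideanSpace ℝ (Fin n))} {A : CotBundle n M → ℝ}
  {O : Set (Pos n)} {H : PhaseSpace n → ℝ} {o : M} {r ε : ℝ}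
  {Z : ℝ × Pos n × Pos n → PhaseSpace n} {Y : ℝ × Pos n × Pos n → Pos n}

theorem contMDiffOn_eikonalPhase (he : e ∈ IsManifold.maximalAtlas (𝓡 n) ∞ M)
    (hY : IsBackwardInverse ε Z Y) :
    ContMDiffOn (𝓘(ℝ, ℝ).prod ((𝓡 n).prod (𝓡 n))) 𝓘(ℝ, ℝ) ∞
      (fun q : ℝ × M × EuclideanSpace ℝ (Fin n) => eikonalPhase e Y q.1 q.2.1 q.2.2)
      (Set.Ioo (-ε) ε ×ˢ coordBall e o r ×ˢ {0}ᶜ) := by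
  rintro ⟨t, x, ξ⟩ ⟨ht, hx, hξ⟩
  apply ContMDiffAt.contMDiffWithinAt
  have hex : ContMDiffAt (𝓡 n) (𝓡 n) ∞ e x :=
    (contMDiffOn_of_mem_maximalAtlas he).contMDiffAt (e.open_source.mem_nhds hx.1)
  have h1 : ContMDiffAt (𝓘(ℝ, ℝ).prod ((𝓡 n).prod (𝓡 n))) 𝓘(ℝ, ℝ × Pos n × Pos n) ∞
      (fun q : ℝ × M × EuclideanSpace ℝ (Fin n) => (q.1, e q.2.1, q.2.2)) (t, x, ξ) := by
    refine contMDiffAt_fst.prodMk_space (ContMDiffAt.prodMk_space ?_ ?_)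
    · exact ContMDiffAt.comp (t, x, ξ) (g := e)
        (f := fun q : ℝ × M × EuclideanSpace ℝ (Fin n) => q.2.1) hex
        (contMDiffAt_fst.comp (t, x, ξ) contMDiffAt_snd)
    · exact contMDiffAt_snd.comp (t, x, ξ) contMDiffAt_snd
  exact ContMDiffAt.comp (t, x, ξ)
    (g := fun q : ℝ × Pos n × Pos n => (inner ℝ (Y q) q.2.2 : ℝ))
    (contDiffAt_inner_backward hY ht (e x) hξ).contMDiffAt h1

/-- `∂_x φ` for `φ = w - c`. The constant `c` is that of `φ(t, x, y, ξ) = w(t, x, ξ) - w(0, y, ξ)`.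
-/
theorem hasMFDerivAt_eikonalPhase_sub [IsManifold (𝓡 n) ∞ M]
    (he : e ∈ IsManifold.maximalAtlas (𝓡 n) ∞ M)
    (h : IsLocalFlow O H (e o) r ε Z) (hY : IsBackwardInverse ε Z Y)
    (hH : IsHomogeneousHamiltonian O H) {t : ℝ} (ht : t ∈ Set.Ioo (-ε) ε) {x : M}
    (hx : x ∈ coordBall e o r) {ξ : Pos n} (hξ : ξ ≠ 0) (c : ℝ) :
    HasMFDerivAt (𝓡 n) 𝓘(ℝ, ℝ) (fun x' => eikonalPhase e Y t x' ξ - c) x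
      ((Z (-t, Y (t, e x, ξ), ξ)).2.comp (chartDeriv e x)) := by
  have h1 := ((h.hasFDerivAt_phase_base hY hH ht hx.2 hξ).sub_const c).hasMFDerivAt
  have h2 := ((mdifferentiable_of_mem_maximalAtlas he).mdifferentiableAt hx.1).hasMFDerivAt
  exact HasMFDerivAt.comp x h1 h2

theorem comp_chartDeriv_flow_ne_zero [IsManifold (𝓡 n) ∞ M]
    (he : e ∈ IsManifold.maximalAtlas (𝓡 n) ∞ M)
    (h : IsLocalFlow O H (e o) r ε Z) (hY : IsBackwardInverse ε Z Y) {t : ℝ}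
    (ht : t ∈ Set.Ioo (-ε) ε) {x : M} (hx : x ∈ coordBall e o r) {ξ : Pos n} (hξ : ξ ≠ 0) :
    (Z (-t, Y (t, e x, ξ), ξ)).2.comp (chartDeriv e x) ≠ 0 :=
  comp_chartDeriv_ne_zero he hx.1 (h.mem _ (IsLocalFlow.neg_mem_Ioo ht) _
    (h.backward_mem_ball hY ht hx.2 hξ) ξ hξ).2

theorem mfderiv_eikonalPhase_sub_ne_zero [IsManifold (𝓡 n) ∞ M]
    (he : e ∈ IsManifold.maximalAtlas (𝓡 n) ∞ M)
    (h : IsLocalFlow O H (e o) r ε Z) (hY : IsBackwardInverse ε Z Y)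
    (hH : IsHomogeneousHamiltonian O H) {t : ℝ} (ht : t ∈ Set.Ioo (-ε) ε) {x : M}
    (hx : x ∈ coordBall e o r) {ξ : Pos n} (hξ : ξ ≠ 0) (c : ℝ) :
    mfderiv (𝓡 n) 𝓘(ℝ, ℝ) (fun x' => eikonalPhase e Y t x' ξ - c) x ≠ 0 := by
  rw [(hasMFDerivAt_eikonalPhase_sub he h hY hH ht hx hξ c).mfderiv]
  exact comp_chartDeriv_flow_ne_zero he h hY ht hx hξ

theorem mfderiv_eikonalPhase_ne_zero [IsManifold (𝓡 n) ∞ M]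
    (he : e ∈ IsManifold.maximalAtlas (𝓡 n) ∞ M)
    (h : IsLocalFlow O H (e o) r ε Z) (hY : IsBackwardInverse ε Z Y)
    (hH : IsHomogeneousHamiltonian O H) {t : ℝ} (ht : t ∈ Set.Ioo (-ε) ε) {x : M}
    (hx : x ∈ coordBall e o r) {ξ : Pos n} (hξ : ξ ≠ 0) :
    mfderiv (𝓡 n) 𝓘(ℝ, ℝ) (fun x' => eikonalPhase e Y t x' ξ) x ≠ 0 := by
  have h1 := hasMFDerivAt_eikonalPhase_sub he h hY hH ht hx hξ 0
  have h2 : (fun x' => eikonalPhase e Y t x' ξ - 0) = fun x' => eikonalPhase e Y t x' ξ :=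
    funext fun x' => sub_zero _
  rw [h2] at h1
  rw [h1.mfderiv]
  exact comp_chartDeriv_flow_ne_zero he h hY ht hx hξ

theorem mfderiv_const_sub_eikonalPhase_ne_zero [IsManifold (𝓡 n) ∞ M]
    (he : e ∈ IsManifold.maximalAtlas (𝓡 n) ∞ M)
    (h : IsLocalFlow O H (e o) r ε Z) (hY : IsBackwardInverse ε Z Y)
    (hH : IsHomogeneousHamiltonian O H) {t : ℝ} (ht : t ∈ Set.Ioo (-ε) ε) {x : M}
    (hx : x ∈ coordBall e o r) {ξ : Pos n} (hξ : ξ ≠ 0) (c : ℝ) :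
    mfderiv (𝓡 n) 𝓘(ℝ, ℝ) (fun x' => c - eikonalPhase e Y t x' ξ) x ≠ 0 := by
  have h1 := (hasMFDerivAt_eikonalPhase_sub he h hY hH ht hx hξ c).neg
  have h2 : (-fun x' => eikonalPhase e Y t x' ξ - c) = fun x' => c - eikonalPhase e Y t x' ξ :=
    funext fun x' => neg_sub _ _
  rw [h2] at h1
  rw [h1.mfderiv]
  exact neg_ne_zero.2 (comp_chartDeriv_flow_ne_zero he h hY ht hx hξ)

theorem isPhaseFunctionOn_eikonalPhase [IsManifold (𝓡 n) ∞ M]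
    (he : e ∈ IsManifold.maximalAtlas (𝓡 n) ∞ M)
    (h : IsLocalFlow O H (e o) r ε Z) (hY : IsBackwardInverse ε Z Y)
    (hH : IsHomogeneousHamiltonian O H) :
    IsPhaseFunctionOn (𝓘(ℝ, ℝ).prod ((𝓡 n).prod (𝓡 n)))
      (Set.Ioo (-ε) ε ×ˢ coordBall e o r ×ˢ coordBall e o r)
      (fun (q : ℝ × M × M) ξ => eikonalPhase e Y q.1 q.2.1 ξ - eikonalPhase e Y 0 q.2.2 ξ) := by
  have hsmooth : ContMDiffOn ((𝓘(ℝ, ℝ).prod ((𝓡 n).prod (𝓡 n))).prod (𝓡 n)) 𝓘(ℝ, ℝ) ∞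
      (fun q : (ℝ × M × M) × EuclideanSpace ℝ (Fin n) =>
        eikonalPhase e Y q.1.1 q.1.2.1 q.2 - eikonalPhase e Y 0 q.1.2.2 q.2)
      ((Set.Ioo (-ε) ε ×ˢ coordBall e o r ×ˢ coordBall e o r) ×ˢ {0}ᶜ) := by
    have hw := contMDiffOn_eikonalPhase (o := o) (r := r) he hY
    refine ContMDiffOn.sub
      (hw.comp (f := fun q : (ℝ × M × M) × EuclideanSpace ℝ (Fin n) => (q.1.1, q.1.2.1, q.2))
        (ContMDiff.contMDiffOn ?_) ?_)
      (hw.comp (f := fun q : (ℝ × M × M) × EuclideanSpace ℝ (Fin n) => ((0 : ℝ), q.1.2.2, q.2))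
        (ContMDiff.contMDiffOn ?_) ?_)
    · exact (contMDiff_fst.comp contMDiff_fst).prodMk
        (((contMDiff_fst.comp contMDiff_snd).comp contMDiff_fst).prodMk contMDiff_snd)
    · exact fun q hq => ⟨hq.1.1, hq.1.2.1, hq.2⟩
    · exact contMDiff_const.prodMk
        (((contMDiff_snd.comp contMDiff_snd).comp contMDiff_fst).prodMk contMDiff_snd)
    · exact fun q hq => ⟨h.zero_mem, hq.1.2.2, hq.2⟩
  refine ⟨hsmooth, ?_, ?_⟩
  · rintro ⟨t, x, y⟩ ⟨ht, -, -⟩ ξ hξ l hl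
    simp only
    rw [eikonalPhase_smul h hY ht x hξ hl, eikonalPhase_smul h hY h.zero_mem y hξ hl, mul_sub]
  · rintro ⟨t, x, y⟩ ⟨ht, hx, hy⟩ ξ hξ
    have hopen : IsOpen ((Set.Ioo (-ε) ε ×ˢ coordBall e o r ×ˢ coordBall e o r) ×ˢ
        ({0}ᶜ : Set (Pos n))) :=
      (isOpen_Ioo.prod ((isOpen_coordBall e o r).prod (isOpen_coordBall e o r))).prod
        isOpen_compl_singleton
    exact mfderiv_ne_zero_of_comp (I₁ := 𝓡 n)
      (g := fun x' => (((t, x', y), ξ) : (ℝ × M × M) × EuclideanSpace ℝ (Fin n)))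
      ((hsmooth.contMDiffAt (hopen.mem_nhds ⟨⟨ht, hx, hy⟩,
        Set.mem_compl_singleton_iff.2 hξ⟩)).mdifferentiableAt (by simp))
      ((contMDiff_const.prodMk (contMDiff_id.prodMk contMDiff_const)).prodMk
        (contMDiff_const (n := 1)) |>.mdifferentiableAt (by simp))
      (mfderiv_eikonalPhase_sub_ne_zero he h hY hH ht hx hξ (eikonalPhase e Y 0 y ξ))

theorem isOperatorPhaseFunctionOn_eikonalPhase [IsManifold (𝓡 n) ∞ M]
    (he : e ∈ IsManifold.maximalAtlas (𝓡 n) ∞ M)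
    (h : IsLocalFlow O H (e o) r ε Z) (hY : IsBackwardInverse ε Z Y)
    (hH : IsHomogeneousHamiltonian O H) {t : ℝ} (ht : t ∈ Set.Ioo (-ε) ε) :
    IsOperatorPhaseFunctionOn (𝓡 n) (𝓡 n) (coordBall e o r) (coordBall e o r)
      (fun (q : M × M) ξ => eikonalPhase e Y t q.1 ξ - eikonalPhase e Y 0 q.2 ξ) := by
  have hP := isPhaseFunctionOn_eikonalPhase he h hY hH
  have hsmooth : ContMDiffOn (((𝓡 n).prod (𝓡 n)).prod (𝓡 n)) 𝓘(ℝ, ℝ) ∞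
      (fun q : (M × M) × EuclideanSpace ℝ (Fin n) =>
        eikonalPhase e Y t q.1.1 q.2 - eikonalPhase e Y 0 q.1.2 q.2)
      ((coordBall e o r ×ˢ coordBall e o r) ×ˢ {0}ᶜ) :=
    hP.smooth.comp
      (f := fun q : (M × M) × EuclideanSpace ℝ (Fin n) => ((t, q.1), q.2))
      ((contMDiff_const.prodMk contMDiff_fst).prodMk contMDiff_snd).contMDiffOn
      (fun q hq => ⟨⟨ht, hq.1⟩, hq.2⟩)
  refine ⟨⟨hsmooth, ?_, ?_⟩, ?_⟩
  · rintro ⟨x, y⟩ hxy ξ hξ l hl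
    exact hP.homogeneous (t, x, y) ⟨ht, hxy⟩ ξ hξ l hl
  · rintro ⟨x, y⟩ ⟨hx, hy⟩ ξ hξ
    have hopen : IsOpen ((coordBall e o r ×ˢ coordBall e o r) ×ˢ ({0}ᶜ : Set (Pos n))) :=
      ((isOpen_coordBall e o r).prod (isOpen_coordBall e o r)).prod isOpen_compl_singleton
    exact mfderiv_ne_zero_of_comp (I₁ := 𝓡 n)
      (g := fun x' => (((x', y), ξ) : (M × M) × EuclideanSpace ℝ (Fin n)))
      ((hsmooth.contMDiffAt (hopen.mem_nhds ⟨⟨hx, hy⟩,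
        Set.mem_compl_singleton_iff.2 hξ⟩)).mdifferentiableAt (by simp))
      ((contMDiff_id.prodMk contMDiff_const).prodMk
        (contMDiff_const (n := 1)) |>.mdifferentiableAt (by simp))
      (mfderiv_eikonalPhase_sub_ne_zero he h hY hH ht hx hξ (eikonalPhase e Y 0 y ξ))
  · exact fun x hx y hy ξ hξ _ =>
      ⟨mfderiv_eikonalPhase_sub_ne_zero he h hY hH ht hx hξ (eikonalPhase e Y 0 y ξ),
      mfderiv_const_sub_eikonalPhase_ne_zero he h hY hH h.zero_mem hy hξ
        (eikonalPhase e Y t x ξ)⟩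

/-! ### The eikonal equation and the exponential map -/

section Exponential

theorem hasDerivAt_eikonalPhase
    (h : IsLocalFlow e.target (fun z => A (ofCanonical e z)) (e o) r ε Z)
    (hY : IsBackwardInverse ε Z Y)
    (hH : IsHomogeneousHamiltonian e.target fun z => A (ofCanonical e z)) {t : ℝ}
    (ht : t ∈ Set.Ioo (-ε) ε) {x : M} (hx : x ∈ coordBall e o r) {ξ : Pos n} (hξ : ξ ≠ 0) :
    HasDerivAt (fun s => eikonalPhase e Y s x ξ)
      (A (ofCanonical e (Y (t, e x, ξ), covec n ξ))) t :=
  h.hasDerivAt_phase_time hY hH ht hx.2 hξ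

theorem eikonal_equation [IsManifold (𝓡 n) ∞ M] (he : e ∈ IsManifold.maximalAtlas (𝓡 n) ∞ M)
    (h : IsLocalFlow e.target (fun z => A (ofCanonical e z)) (e o) r ε Z)
    (hY : IsBackwardInverse ε Z Y)
    (hH : IsHomogeneousHamiltonian e.target fun z => A (ofCanonical e z)) {t : ℝ}
    (ht : t ∈ Set.Ioo (-ε) ε) {x : M} (hx : x ∈ coordBall e o r) {ξ : Pos n} (hξ : ξ ≠ 0)
    (c : ℝ) :
    deriv (fun s => eikonalPhase e Y s x ξ - c) t =
      A (differential n (fun x' => eikonalPhase e Y t x' ξ - c) x) := by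
  rw [((hasDerivAt_eikonalPhase h hY hH ht hx hξ).sub_const c).deriv, differential,
    (hasMFDerivAt_eikonalPhase_sub he h hY hH ht hx hξ c).mfderiv, ← ofCanonical_apply hx.1]
  exact (h.hamiltonian_phase_base hY hH ht hx.2 hξ).symm

theorem hamFlow_coordForm [IsManifold (𝓡 n) ∞ M] [T2Space M]
    (he : e ∈ IsManifold.maximalAtlas (𝓡 n) ∞ M)
    (hA : ContMDiffOn (cotModel n) 𝓘(ℝ, ℝ) ∞ A (slitCotBundle n M))
    (h : IsLocalFlow e.target (fun z => A (ofCanonical e z)) (e o) r ε Z) {t : ℝ}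
    (ht : t ∈ Set.Ioo (-ε) ε) {y : M} (hy : y ∈ coordBall e o r) {ξ : Pos n} (hξ : ξ ≠ 0) :
    (⟨y, coordForm e ξ y⟩ : CotBundle n M) ∈ flowDomain (slitCotBundle n M) A t ∧
      hamFlow (slitCotBundle n M) A t ⟨y, coordForm e ξ y⟩ = ofCanonical e (Z (t, e y, ξ)) := by
  have hy2 := mem_ball_two_of_mem_coordBall h.r_pos hy
  have h1 := hamFlow_eq_of_chart he hA (z := fun s => Z (s, e y, ξ)) h.zero_mem
    (fun s hs => h.mem s hs _ hy2 ξ hξ) (fun s hs => h.hasDerivAt s hs _ hy2 ξ hξ) ht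
  simp only [h.initial _ ξ hξ, ofCanonical_apply hy.1] at h1
  exact h1

theorem expMap_coordForm [IsManifold (𝓡 n) ∞ M] [T2Space M]
    (he : e ∈ IsManifold.maximalAtlas (𝓡 n) ∞ M)
    (hA : ContMDiffOn (cotModel n) 𝓘(ℝ, ℝ) ∞ A (slitCotBundle n M))
    (h : IsLocalFlow e.target (fun z => A (ofCanonical e z)) (e o) r ε Z) {t : ℝ}
    (ht : t ∈ Set.Ioo (-ε) ε) {y : M} (hy : y ∈ coordBall e o r) {ξ : Pos n} (hξ : ξ ≠ 0) :
    expMap (slitCotBundle n M) A y t (coordForm e ξ y) = e.symm (Z (t, e y, ξ)).1 := by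
  rw [expMap, (hamFlow_coordForm he hA h ht hy hξ).2]
  rfl

theorem gradient_eq_iff_expMap_eq [IsManifold (𝓡 n) ∞ M] [T2Space M]
    (he : e ∈ IsManifold.maximalAtlas (𝓡 n) ∞ M)
    (hA : ContMDiffOn (cotModel n) 𝓘(ℝ, ℝ) ∞ A (slitCotBundle n M))
    (h : IsLocalFlow e.target (fun z => A (ofCanonical e z)) (e o) r ε Z)
    (hY : IsBackwardInverse ε Z Y)
    (hH : IsHomogeneousHamiltonian e.target fun z => A (ofCanonical e z)) {t : ℝ}
    (ht : t ∈ Set.Ioo (-ε) ε) {x y : M} (hx : x ∈ coordBall e o r) (hy : y ∈ coordBall e o r)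
    {ξ : Pos n} (hξ : ξ ≠ 0) :
    gradient (eikonalPhase e Y t x) ξ = e y ↔
      expMap (slitCotBundle n M) A y (-t) (coordForm e ξ y) = x := by
  have ht' := IsLocalFlow.neg_mem_Ioo ht
  have hm := (h.mem _ ht' _ (mem_ball_two_of_mem_coordBall h.r_pos hy) ξ hξ).1
  rw [gradient_eikonalPhase h hY hH ht hx hξ, hY.iff t ht _ _ ξ hξ,
    expMap_coordForm he hA h ht' hy hξ]
  exact ⟨fun h1 => by rw [h1, e.left_inv hx.1], fun h1 => by rw [← h1, e.right_inv hm]⟩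

/-- The differential of the exponential map in the coordinates: the coefficients of the covector are
taken to the base component of the flow, and this to the manifold. -/
theorem hasMFDerivAt_expMapNormed [IsManifold (𝓡 n) ∞ M] [T2Space M]
    (he : e ∈ IsManifold.maximalAtlas (𝓡 n) ∞ M)
    (hA : ContMDiffOn (cotModel n) 𝓘(ℝ, ℝ) ∞ A (slitCotBundle n M))
    (h : IsLocalFlow e.target (fun z => A (ofCanonical e z)) (e o) r ε Z) {t : ℝ}
    (ht : t ∈ Set.Ioo (-ε) ε) {y : M} (hy : y ∈ coordBall e o r) {ξ : Pos n} (hξ : ξ ≠ 0)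
    {η : Pos n →L[ℝ] ℝ} (hη : coordCoeff e y η = ξ) :
    HasMFDerivAt 𝓘(ℝ, EuclideanSpace ℝ (Fin n) →L[ℝ] ℝ) (𝓡 n)
      (expMapNormed (slitCotBundle n M) A y t) η
      ((mfderiv (𝓡 n) (𝓡 n) e.symm (Z (t, e y, ξ)).1 : Pos n →L[ℝ] Pos n).comp
        ((fderiv ℝ (fun ξ' => (Z (t, e y, ξ')).1) ξ).comp (coordCoeff e y))) := by
  subst hη
  have hm := (h.mem _ ht _ (mem_ball_two_of_mem_coordBall h.r_pos hy) _ hξ).1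
  have hZ : HasFDerivAt (fun ξ' => (Z (t, e y, ξ')).1)
      (fderiv ℝ (fun ξ' => (Z (t, e y, ξ')).1) (coordCoeff e y η)) (coordCoeff e y η) :=
    ((((h.contDiffAt ht (e y) hξ).differentiableAt (by simp)).comp (coordCoeff e y η)
      (f := fun ξ' => ((t, e y, ξ') : ℝ × Pos n × Pos n)) (by fun_prop)).fst).hasFDerivAt
  have h1 := (HasFDerivAt.comp η hZ (coordCoeff e y).hasFDerivAt).hasMFDerivAt
  have h2 := ((mdifferentiable_of_mem_maximalAtlas he).mdifferentiableAt_symm hm).hasMFDerivAt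
  refine (HasMFDerivAt.comp η h2 h1).congr_of_eventuallyEq ?_
  have hne : ∀ᶠ η' : Pos n →L[ℝ] ℝ in 𝓝 η, coordCoeff e y η' ≠ 0 :=
    (coordCoeff e y).continuous.continuousAt.eventually_ne hξ
  filter_upwards [hne] with η' hη'
  have h3 := expMap_coordForm he hA h ht hy hη'
  rw [coordForm_coordCoeff he hy.1 η'] at h3
  exact h3

/-- The differential of the exponential map has the rank of `∂_ξ X`, because the other two factors of
`hasMFDerivAt_expMapNormed` are isomorphisms. -/
theorem finrank_dExp [IsManifold (𝓡 n) ∞ M] [T2Space M]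
    (he : e ∈ IsManifold.maximalAtlas (𝓡 n) ∞ M)
    (hA : ContMDiffOn (cotModel n) 𝓘(ℝ, ℝ) ∞ A (slitCotBundle n M))
    (h : IsLocalFlow e.target (fun z => A (ofCanonical e z)) (e o) r ε Z) {t : ℝ}
    (ht : t ∈ Set.Ioo (-ε) ε) {y : M} (hy : y ∈ coordBall e o r) {ξ : Pos n} (hξ : ξ ≠ 0) :
    Module.finrank ℝ (dExp (slitCotBundle n M) A y t (coordForm e ξ y)).range =
      Module.finrank ℝ (fderiv ℝ (fun ξ' => (Z (t, e y, ξ')).1) ξ).range := by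
  have hm := (h.mem _ ht _ (mem_ball_two_of_mem_coordBall h.r_pos hy) ξ hξ).1
  have hinj := ((mdifferentiable_of_mem_maximalAtlas he).symm).mfderiv_injective hm
  have hsurj : Function.Surjective (coordCoeff e y) := fun ξ' =>
    ⟨_, coordCoeff_coordForm he hy.1 ξ'⟩
  rw [dExp, (hasMFDerivAt_expMapNormed he hA h ht hy hξ
    (coordCoeff_coordForm he hy.1 ξ)).mfderiv]
  set G := fderiv ℝ (fun ξ' => (Z (t, e y, ξ')).1) ξ
  set S : Pos n →L[ℝ] Pos n := mfderiv (𝓡 n) (𝓡 n) e.symm (Z (t, e y, ξ)).1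
  change Module.finrank ℝ
    ((S : Pos n →ₗ[ℝ] Pos n) ∘ₗ (G : Pos n →ₗ[ℝ] Pos n) ∘ₗ
      (coordCoeff e y : (Pos n →L[ℝ] ℝ) →ₗ[ℝ] Pos n)).range = _
  rw [LinearMap.range_comp, LinearMap.range_comp, LinearMap.range_eq_top.2 hsurj,
    Submodule.map_top]
  exact (Submodule.equivMapOfInjective (S : Pos n →ₗ[ℝ] Pos n) hinj _).finrank_eq.symm

end Exponential

end Phase

end Eikonal

end

theorem proposition3p12 {n : ℕ} {M : Type*} [TopologicalSpace M] [T2Space M]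
    [ChartedSpace (EuclideanSpace ℝ (Fin n)) M] [IsManifold (𝓡 n) ∞ M]
    (A : Eikonal.CotBundle n M → ℝ)
    (hA : ContMDiffOn (Eikonal.cotModel n) 𝓘(ℝ, ℝ) ∞ A (Eikonal.slitCotBundle n M))
    (hom : ∀ (x : M) (α : Eikonal.CotSpace n x), α ≠ 0 → ∀ l : ℝ, 0 < l →
      A ⟨x, l • α⟩ = l * A ⟨x, α⟩)
    (o : M) (e : OpenPartialHomeomorph M (EuclideanSpace ℝ (Fin n)))
    (he : e ∈ IsManifold.maximalAtlas (𝓡 n) ∞ M) (ho : o ∈ e.source) :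
    ∃ (V : Set M) (ε : ℝ) (w : ℝ → M → EuclideanSpace ℝ (Fin n) → ℝ),
      IsOpen V ∧ o ∈ V ∧ V ⊆ e.source ∧ 0 < ε ∧
      -- `w` is smooth on `(-ε, ε) × V × (ℝ^n ∖ 0)`
      ContMDiffOn (𝓘(ℝ, ℝ).prod ((𝓡 n).prod (𝓡 n))) 𝓘(ℝ, ℝ) ∞
        (fun q : ℝ × M × EuclideanSpace ℝ (Fin n) => w q.1 q.2.1 q.2.2)
        (Set.Ioo (-ε) ε ×ˢ V ×ˢ {0}ᶜ) ∧
      -- (i)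
      (∀ t ∈ Set.Ioo (-ε) ε, ∀ x ∈ V, ∀ ξ : EuclideanSpace ℝ (Fin n), ξ ≠ 0 →
        (∀ l : ℝ, 0 < l → w t x (l • ξ) = l * w t x ξ) ∧
        w 0 x ξ = inner ℝ (e x) ξ ∧
        mfderiv (𝓡 n) 𝓘(ℝ, ℝ) (fun x' => w t x' ξ) x ≠ 0) ∧
      -- (ii), with `φ(t, x, y, ξ) = w(t, x, ξ) - w(0, y, ξ)`
      Eikonal.IsPhaseFunctionOn (𝓘(ℝ, ℝ).prod ((𝓡 n).prod (𝓡 n)))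
        (Set.Ioo (-ε) ε ×ˢ V ×ˢ V)
        (fun (q : ℝ × M × M) ξ => w q.1 q.2.1 ξ - w 0 q.2.2 ξ) ∧
      (∀ t ∈ Set.Ioo (-ε) ε, ∀ x ∈ V, ∀ y ∈ V, ∀ ξ : EuclideanSpace ℝ (Fin n), ξ ≠ 0 →
        deriv (fun s => w s x ξ - w 0 y ξ) t =
          A (Eikonal.differential n (fun x' => w t x' ξ - w 0 y ξ) x) ∧
        w 0 x ξ - w 0 y ξ = inner ℝ (e x - e y) ξ) ∧
      (∀ t ∈ Set.Ioo (-ε) ε, Eikonal.IsOperatorPhaseFunctionOn (𝓡 n) (𝓡 n) V V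
        (fun (q : M × M) ξ => w t q.1 ξ - w 0 q.2 ξ)) ∧
      -- the exponential maps in (iii) and (iv) are defined where they are used
      (∀ t ∈ Set.Ioo (-ε) ε, ∀ y ∈ V, ∀ ξ : EuclideanSpace ℝ (Fin n), ξ ≠ 0 →
        (⟨y, Eikonal.coordForm e ξ y⟩ : Eikonal.CotBundle n M) ∈
          Eikonal.flowDomain (Eikonal.slitCotBundle n M) A (-t)) ∧
      -- (iii)
      (∀ t ∈ Set.Ioo (-ε) ε, ∀ x ∈ V, ∀ y ∈ V, ∀ ξ : EuclideanSpace ℝ (Fin n), ξ ≠ 0 →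
        (gradient (w t x) ξ = e y ↔
          Eikonal.expMap (Eikonal.slitCotBundle n M) A y (-t) (Eikonal.coordForm e ξ y) = x) ∧
        (gradient (w t x) ξ = e y →
          deriv (fun s => w s x ξ) t = A ⟨y, Eikonal.coordForm e ξ y⟩)) ∧
      -- (iv)
      (∀ t ∈ Set.Ioo (-ε) ε, ∀ x ∈ V, ∀ y ∈ V, ∀ ξ : EuclideanSpace ℝ (Fin n), ξ ≠ 0 →
        gradient (w t x) ξ = e y →
          Eikonal.ExpDifferentiableAt (Eikonal.slitCotBundle n M) A y (-t)
            (Eikonal.coordForm e ξ y) ∧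
          Module.finrank ℝ (fderiv ℝ (gradient (w t x)) ξ).range =
            Module.finrank ℝ
              (Eikonal.dExp (Eikonal.slitCotBundle n M) A y (-t) (Eikonal.coordForm e ξ y)).range) := by
  have hH : Eikonal.IsHomogeneousHamiltonian e.target fun z => A (Eikonal.ofCanonical e z) :=
    ⟨e.open_target, Eikonal.contDiffOn_comp_ofCanonical he hA,
      Eikonal.homogeneous_comp_ofCanonical he hom⟩
  obtain ⟨r, ε, Z, h⟩ := Eikonal.exists_isLocalFlow hH (e.map_source ho)
  obtain ⟨Y, hY⟩ := h.exists_isBackwardInverse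
  refine ⟨Eikonal.coordBall e o r, ε, Eikonal.eikonalPhase e Y, Eikonal.isOpen_coordBall e o r,
    ⟨ho, Metric.mem_ball_self h.r_pos⟩, Set.inter_subset_left, h.ε_pos,
    Eikonal.contMDiffOn_eikonalPhase he hY, ?_,
    Eikonal.isPhaseFunctionOn_eikonalPhase he h hY hH, ?_,
    fun t ht => Eikonal.isOperatorPhaseFunctionOn_eikonalPhase he h hY hH ht,
    fun t ht y hy ξ hξ =>
      (Eikonal.hamFlow_coordForm he hA h (Eikonal.IsLocalFlow.neg_mem_Ioo ht) hy hξ).1, ?_, ?_⟩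
  · exact fun t ht x hx ξ hξ => ⟨fun l hl => Eikonal.eikonalPhase_smul h hY ht x hξ hl,
      Eikonal.eikonalPhase_zero h hY x hξ, Eikonal.mfderiv_eikonalPhase_ne_zero he h hY hH ht hx hξ⟩
  · refine fun t ht x hx y hy ξ hξ => ⟨Eikonal.eikonal_equation he h hY hH ht hx hξ _, ?_⟩
    rw [Eikonal.eikonalPhase_zero h hY x hξ, Eikonal.eikonalPhase_zero h hY y hξ, inner_sub_left]
  · refine fun t ht x hx y hy ξ hξ =>
      ⟨Eikonal.gradient_eq_iff_expMap_eq he hA h hY hH ht hx hy hξ, fun hg => ?_⟩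
    rw [Eikonal.gradient_eikonalPhase h hY hH ht hx hξ] at hg
    rw [(Eikonal.hasDerivAt_eikonalPhase h hY hH ht hx hξ).deriv, hg,
      Eikonal.ofCanonical_apply hy.1, ← Eikonal.coordForm_eq]
  · intro t ht x hx y hy ξ hξ hg
    rw [Eikonal.gradient_eikonalPhase h hY hH ht hx hξ] at hg
    have ht' := Eikonal.IsLocalFlow.neg_mem_Ioo ht
    refine ⟨(Eikonal.hasMFDerivAt_expMapNormed he hA h ht' hy hξ
      (Eikonal.coordCoeff_coordForm he hy.1 ξ)).mdifferentiableAt, ?_⟩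
    rw [Eikonal.fderiv_gradient_eikonalPhase h hY hH ht hx hξ,
      h.finrank_range_backward hY ht _ hξ, Eikonal.finrank_dExp he hA h ht' hy hξ, hg]
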